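/- All systems are finite-dimensional. Let $\Theta\subseteq\mathbb{R}$ and let $\theta\in\Theta$ be an accumulation point of $\Theta$; derivatives are taken within $\Theta$. For a differentiable family $\{\rho_t\}_{t\in\Theta}$ of density operators, the SLD Fisher information at $\theta$ is $$I_F(\theta;\{\rho_t\}_t)=\begin{cases}2\left\|(\rho_\theta\otimes I+I\otimes\rho_\theta^{T})^{-1/2}\big((\partial_\theta\rho_\theta)\otimes I\big)|\Gamma\rangle\right\|_2^2 & \text{if }\Pi^\perp_{\rho_\theta}(\partial_\theta\rho_\theta)\Pi^\perp_{\rho_\theta}=0,\\ +\infty&\text{otherwise,}\end{cases}$$ where $|\Gamma\rangle=\sum_i|i\rangle|i\rangle$, $\Pi^\perp_{\rho}$ is the projection onto $\ker\rho$, and the inverse is taken on the support. For a family $\{\mathcal{N}^t_{A\to B}\}_t$ of channels put $$I_F(\theta;\{\mathcal{N}^t\}_t)=\sup_{\rho_{RA}}I_F(\theta;\{\mathcal{N}^t(\rho_{RA})\}_t),\qquad I_F^{\mathcal{A}}(\theta;\{\mathcal{N}^t\}_t)=\sup_{\{\rho^t_{RA}\}_t}\big[I_F(\theta;\{\mathcal{N}^t(\rho^t_{RA})\}_t)-I_F(\theta;\{\rho^t_{RA}\}_t)\big],$$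 the suprema being over reference systems $R$ of arbitrary finite dimension and, respectively, over states $\rho_{RA}$ and over differentiable families of states $\{\rho_{RA}^t\}_{t\in\Theta}$ (families with $I_F(\theta;\{\rho^t_{RA}\}_t)=\infty$ do not contribute to the second supremum). Theorem. Let $X$ be a finite nonempty alphabet, let $\{\omega_B^{x,t}\}_{t\in\Theta}$, $x\in X$, be differentiable families of states, and let $\mathcal{N}^t_{X\to B}(\sigma)=\sum_x\langle x|\sigma|x\rangle\,\omega_B^{x,t}$ be the corresponding classical--quantum channels. Then 1. $I_F(\theta;\{\mathcal{N}^t\}_t)=I_F^{\mathcal{A}}(\theta;\{\mathcal{N}^t\}_t)=\sup_xI_F(\theta;\{\omega_B^{x,t}\}_t)$. 2. For every $n\ge1$, the supremum of the Fisher information of the final state over all parallel strategies with $n$ channel uses, $I_F(\theta;\{(\mathcal{N}^t)^{\otimes n}\}_t)$, and the supremum of the Fisher information of the final state over all sequential (adaptive) strategies with $n$ channel uses (an input state on $R_1A_1$ and channels $R_iB_i\to R_{i+1}A_{i+1}$ between consecutive uses, none depending on $t$) are both equal to $n\sup_xI_F(\theta;\{\omega_B^{x,t}\}_t)$. Hence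 sequential strategies give no advantage over parallel ones, and the Fisher information scales linearly in $n$, so that Heisenberg scaling ($n^2$) is impossible whenever $\sup_xI_F(\theta;\{\omega_B^{x,t}\}_t)<\infty$. 3. If a POVM with real outcomes on the final state of a sequential strategy with $n\ge1$ uses yields an estimator $\hat\theta$ that is unbiased for every $t\in\Theta$, then its mean squared error at $\theta$ satisfies $$\operatorname{Var}(\hat\theta)\ \ge\ \frac{1}{n\,\sup_xI_F(\theta;\{\omega_B^{x,t}\}_t)},$$ with $1/0=\infty$ and $1/\infty=0$. -/

import Mathlib

open scoped ENNReal Matrix Kronecker ComplexOrder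

noncomputable section

namespace CQ

/-! ### States and their SLD Fisher information -/

/-- Density operators on `ℂⁿ`: positive semi-definite matrices of trace one. -/
def IsDensity {n : Type*} [Fintype n] (ρ : Matrix n n ℂ) : Prop :=
  ρ.PosSemidef ∧ ρ.trace = 1

/-- A family of quantum states indexed by `Θ ⊆ ℝ` that is differentiable on `Θ` (entrywise). -/
def IsDiffStateFamily {n : Type*} [Fintype n] (Θ : Set ℝ) (ρ : ℝ → Matrix n n ℂ) : Prop :=
  (∀ t ∈ Θ, IsDensity (ρ t)) ∧ ∀ i j, DifferentiableOn ℝ (fun t => ρ t i j) Θ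

/-- The derivative `∂_θ ρ_θ` of a matrix family on the parameter set `Θ`, taken entrywise. -/
def matDeriv {n : Type*} (Θ : Set ℝ) (ρ : ℝ → Matrix n n ℂ) (θ : ℝ) : Matrix n n ℂ :=
  Matrix.of fun i j => derivWithin (fun t => ρ t i j) Θ θ

/-- The projection `Π_ρ^⊥` onto the kernel of a Hermitian matrix `ρ`, as the spectral projection
for the eigenvalue `0`. -/
def kerProj {n : Type*} [Fintype n] [DecidableEq n] (ρ : Matrix n n ℂ) : Matrix n n ℂ :=
  cfc (fun x : ℝ => if x = 0 then 1 else 0) ρ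

/-- `K^{-1/2}` for a positive semi-definite `K`, the inverse being taken on the support of `K`. -/
def invSqrtOnSupport {n : Type*} [Fintype n] [DecidableEq n] (K : Matrix n n ℂ) : Matrix n n ℂ :=
  cfc (fun x : ℝ => if x = 0 then 0 else (Real.sqrt x)⁻¹) K

/-- The unnormalized maximally entangled vector `|Γ⟩ = ∑ᵢ |i⟩|i⟩`. -/
def gammaVec (n : Type*) [DecidableEq n] : n × n → ℂ :=
  fun p => if p.1 = p.2 then 1 else 0

open Classical in
/-- The SLD Fisher information as a function of the state `ρ` and of its derivative `D`:
`2 ‖(ρ ⊗ I + I ⊗ ρᵀ)^{-1/2} (D ⊗ I) |Γ⟩‖₂²` if `Π_ρ^⊥ D Π_ρ^⊥ = 0`, and `+∞` otherwise. -/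
def sldInfo {n : Type*} [Fintype n] [DecidableEq n] (ρ D : Matrix n n ℂ) : ℝ≥0∞ :=
  if kerProj ρ * D * kerProj ρ = 0 then
    ENNReal.ofReal (2 * ∑ p : n × n,
      ‖(invSqrtOnSupport (ρ ⊗ₖ (1 : Matrix n n ℂ) + (1 : Matrix n n ℂ) ⊗ₖ ρᵀ) *ᵥ
        ((D ⊗ₖ (1 : Matrix n n ℂ)) *ᵥ gammaVec n)) p‖ ^ 2)
  else ⊤

/-- The SLD Fisher information `I_F(θ; {ρ_θ}_θ)` of a family of states on `Θ`. -/
def sldFisher {n : Type*} [Fintype n] [DecidableEq n] (Θ : Set ℝ) (ρ : ℝ → Matrix n n ℂ)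
    (θ : ℝ) : ℝ≥0∞ :=
  sldInfo (ρ θ) (matDeriv Θ ρ θ)

/-! ### Channels -/

/-- `id_R ⊗ Φ`, acting on operators of the composite system `R ⊗ A`. -/
def ampl {A B : Type*} (R : Type*) (Φ : Matrix A A ℂ →ₗ[ℂ] Matrix B B ℂ)
    (M : Matrix (R × A) (R × A) ℂ) : Matrix (R × B) (R × B) ℂ :=
  Matrix.of fun p q => Φ (Matrix.of fun a a' => M (p.1, a) (q.1, a')) p.2 q.2

/-- Quantum channels: completely positive, trace-preserving linear maps. -/
def IsChannel {A B : Type*} [Fintype A] [Fintype B] (Φ : Matrix A A ℂ →ₗ[ℂ] Matrix B B ℂ) :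
    Prop :=
  (∀ (r : ℕ) (M : Matrix (Fin r × A) (Fin r × A) ℂ), M.PosSemidef →
    (ampl (Fin r) Φ M).PosSemidef) ∧ ∀ M, (Φ M).trace = M.trace

/-- The classical-quantum map `σ ↦ ∑ₓ ⟨x|σ|x⟩ ω^x`. -/
def cqChannel {X B : Type*} [Fintype X] (ω : X → Matrix B B ℂ) :
    Matrix X X ℂ →ₗ[ℂ] Matrix B B ℂ where
  toFun σ := ∑ x, σ x x • ω x
  map_add' σ τ := by simp [add_smul, Finset.sum_add_distrib]
  map_smul' c σ := by simp [Finset.smul_sum, smul_smul]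

/-- The `n`-fold tensor power `Φ^{⊗ n}`, from operators on `A^{⊗ n}` to operators on `B^{⊗ n}`:
the linear map that sends `|a⟩⟨a'|` to `⨂ᵢ Φ(|aᵢ⟩⟨a'ᵢ|)`. -/
def tensorPow {A B : Type*} [Fintype A] [DecidableEq A] (n : ℕ)
    (Φ : Matrix A A ℂ →ₗ[ℂ] Matrix B B ℂ) :
    Matrix (Fin n → A) (Fin n → A) ℂ →ₗ[ℂ] Matrix (Fin n → B) (Fin n → B) ℂ where
  toFun M := Matrix.of fun b b' =>
    ∑ a : Fin n → A, ∑ a' : Fin n → A,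
      M a a' * ∏ i, Φ (Matrix.single (a i) (a' i) 1) (b i) (b' i)
  map_add' M N := by
    ext b b'
    simp [add_mul, Finset.sum_add_distrib]
  map_smul' c M := by
    ext b b'
    simp [Finset.mul_sum, mul_assoc]

/-! ### Fisher informations of channel families -/

section
variable {A B : Type*} [Fintype A] [DecidableEq A] [Fintype B] [DecidableEq B]

/-- The SLD Fisher information of a family of channels: the supremum, over all finite-dimensional
reference systems `R` and all states `ρ_{RA}`, of the SLD Fisher information of the output. -/
def channelFisher (Θ : Set ℝ) (N : ℝ → Matrix A A ℂ →ₗ[ℂ] Matrix B B ℂ) (θ : ℝ) : ℝ≥0∞ :=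
  ⨆ (r : ℕ) (ρ : Matrix (Fin r × A) (Fin r × A) ℂ) (_ : IsDensity ρ),
    sldFisher Θ (fun t => ampl (Fin r) (N t) ρ) θ

/-- The amortized SLD Fisher information of a family of channels: the supremum, over all
finite-dimensional reference systems `R` and all differentiable families of states `ρ_{RA}^θ`, of
the SLD Fisher information of the output minus that of the input. The difference is taken in the
extended reals, with `∞ - ∞ = -∞`: an input family of infinite Fisher information does not
contribute to the supremum. -/
def amortizedFisher (Θ : Set ℝ) (N : ℝ → Matrix A A ℂ →ₗ[ℂ] Matrix B B ℂ) (θ : ℝ) : EReal :=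
  ⨆ (r : ℕ) (ρ : ℝ → Matrix (Fin r × A) (Fin r × A) ℂ) (_ : IsDiffStateFamily Θ ρ),
    ((sldFisher Θ (fun t => ampl (Fin r) (N t) (ρ t)) θ : ℝ≥0∞) : EReal)
      - ((sldFisher Θ ρ θ : ℝ≥0∞) : EReal)

end

/-! ### Sequential estimation protocols -/

/-- A sequential (adaptive) strategy for probing a channel from `A` to `B`: an input state on
`R₀ ⊗ A` and interleaved channels `R_i ⊗ B → R_{i+1} ⊗ A`. For `k + 1` uses of the channel only
the first `k` interleaved channels play a role. -/
structure SeqStrategy (A B : Type*) [Fintype A] [Fintype B] where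
  /-- dimensions of the memory systems -/
  dim : ℕ → ℕ
  /-- the input state -/
  init : Matrix (Fin (dim 0) × A) (Fin (dim 0) × A) ℂ
  init_isDensity : IsDensity init
  /-- the interleaved channels -/
  step : ∀ i, Matrix (Fin (dim i) × B) (Fin (dim i) × B) ℂ →ₗ[ℂ]
    Matrix (Fin (dim (i + 1)) × A) (Fin (dim (i + 1)) × A) ℂ
  step_isChannel : ∀ i, IsChannel (step i)

/-- The state on memory and channel output after `k + 1` uses of the channel `Φ`. -/
def SeqStrategy.output {A B : Type*} [Fintype A] [Fintype B] (S : SeqStrategy A B)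
    (Φ : Matrix A A ℂ →ₗ[ℂ] Matrix B B ℂ) :
    ∀ k : ℕ, Matrix (Fin (S.dim k) × B) (Fin (S.dim k) × B) ℂ
  | 0 => ampl _ Φ S.init
  | k + 1 => ampl _ Φ (S.step k (S.output Φ k))

/-- A measurement (POVM) whose outcome is a real number. -/
def IsPOVM {n : Type*} [Fintype n] [DecidableEq n]
    (Λ : MeasureTheory.VectorMeasure ℝ (Matrix n n ℂ)) : Prop :=
  (∀ s, (Λ s).PosSemidef) ∧ Λ Set.univ = 1

/-- `P` is the law of the outcome of the measurement `Λ` on the state `ρ`, by the Born rule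
`P(s) = Tr[Λ(s) ρ]`. -/
def IsBornLaw {n : Type*} [Fintype n] (Λ : MeasureTheory.VectorMeasure ℝ (Matrix n n ℂ))
    (ρ : Matrix n n ℂ) (P : MeasureTheory.Measure ℝ) : Prop :=
  ∀ s, MeasurableSet s → P s = ENNReal.ofReal (Λ s * ρ).trace.re

end CQ

end

/-! Everything rests on a variational formula: the SLD Fisher information of a state `ρ` with
derivative `D` is the supremum over Hermitian `H` of `2 Tr[D H] - Tr[ρ H²]` (`sldObj`), including
the case where it is infinite. The two halves are `ofReal_sldObj_le_sldInfo` and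
`sldInfo_le_of_forall`. An upper bound then only requires a bound for each observable, and a lower
bound only requires a good observable.

The heart is the chain inequality `sldInfo_cq_le`. The output of a classical-quantum channel is `∑ₓ
ρₓ ⊗ ωˣ`, where `ρₓ` are the diagonal blocks of the input. On each block an observable `H` splits
into its conditional expectation `Gₓ ⊗ 1`, with `Gₓ = Tr_B[(1 ⊗ ωˣ) H]`, and a remainder orthogonal
to it. The blocks `Gₓ` together form one observable on the input, bounded by the input's Fisher
information; the remainders contribute at most `Tr ρₓ` times the information of `ωˣ`. As the weights
`Tr ρₓ` sum to one, a single use gains at most the largest information of an output state. Sending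
the best letter attains this gain.

For sequential strategies the chain inequality is iterated, with data processing
(`IsChannel.sldInfo_map_le`, from Kadison's inequality) between uses. For parallel strategies,
`N^{⊗n}` is again classical-quantum, with product output states, and the information is additive on
products (`sldInfo_kronecker`). The Cramér–Rao bound follows by inserting multiples of the
observable `∫ (y - θ) dΛ(y)`, approximated by simple functions, into the variational formula. -/

open scoped ENNReal Matrix Kronecker ComplexOrder
open Matrix

namespace CQ

/-! ### Functional calculus on the support, and a quadratic variational problem. -/

section Spectral

variable {m : Type*} [Fintype m]

theorem re_star_dotProduct_self (v : m → ℂ) :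
    (star v ⬝ᵥ v).re = ∑ p, ‖v p‖ ^ 2 := by
  simp only [dotProduct, Pi.star_apply, Complex.re_sum]
  refine Finset.sum_congr rfl fun p _ => ?_
  rw [Complex.star_def, ← Complex.normSq_eq_conj_mul_self, Complex.ofReal_re,
    Complex.normSq_eq_norm_sq]

theorem star_dotProduct_mulVec_isHermitian {S : Matrix m m ℂ} (hS : S.IsHermitian)
    (u w : m → ℂ) : star u ⬝ᵥ S *ᵥ w = star (S *ᵥ u) ⬝ᵥ w := by
  rw [star_mulVec, hS.eq, dotProduct_mulVec]

theorem re_star_dotProduct_comm (u w : m → ℂ) : (star u ⬝ᵥ w).re = (star w ⬝ᵥ u).re := by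
  rw [← Complex.conj_re, ← Complex.star_def, ← star_dotProduct, dotProduct_comm]

variable [DecidableEq m]

theorem continuousOn_real_spectrum (K : Matrix m m ℂ) (f : ℝ → ℝ) :
    ContinuousOn f (spectrum ℝ K) :=
  Matrix.finite_real_spectrum.continuousOn f

theorem isHermitian_cfc (K : Matrix m m ℂ) (f : ℝ → ℝ) : (cfc f K).IsHermitian :=
  cfc_predicate f K

theorem PosSemidef.spectrum_nonneg {K : Matrix m m ℂ} (hK : K.PosSemidef) {x : ℝ}
    (hx : x ∈ spectrum ℝ K) : 0 ≤ x := by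
  have h := (Matrix.posSemidef_iff_isHermitian_and_spectrum_nonneg.1 hK).2
    ((spectrum.algebraMap_mem_iff ℂ (r := x)).2 hx)
  simpa using h

theorem cfc_sqrt_mul_self {K : Matrix m m ℂ} (hK : K.PosSemidef) :
    cfc Real.sqrt K * cfc Real.sqrt K = K := by
  rw [← cfc_mul _ _ K (continuousOn_real_spectrum K _) (continuousOn_real_spectrum K _)]
  conv_rhs => rw [← cfc_id' ℝ K hK.isHermitian.isSelfAdjoint]
  exact cfc_congr fun x hx => Real.mul_self_sqrt (PosSemidef.spectrum_nonneg hK hx)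

theorem one_sub_kerProj {K : Matrix m m ℂ} (hK : K.IsHermitian) :
    1 - kerProj K = cfc (fun x : ℝ => if x = 0 then 0 else 1) K := by
  have h1 : (1 : Matrix m m ℂ) = cfc (fun _ : ℝ => (1 : ℝ)) K := by
    rw [cfc_const_one ℝ K hK.isSelfAdjoint]
  rw [kerProj]
  conv_lhs => rw [h1]
  rw [← cfc_sub _ _ K (continuousOn_real_spectrum K _) (continuousOn_real_spectrum K _)]
  refine cfc_congr fun x _ => ?_
  by_cases h : x = 0 <;> simp [h]

theorem cfc_sqrt_mul_invSqrtOnSupport {K : Matrix m m ℂ} (hK : K.PosSemidef) :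
    cfc Real.sqrt K * invSqrtOnSupport K = 1 - kerProj K := by
  rw [one_sub_kerProj hK.isHermitian, invSqrtOnSupport,
    ← cfc_mul _ _ K (continuousOn_real_spectrum K _) (continuousOn_real_spectrum K _)]
  refine cfc_congr fun x hx => ?_
  have h0 := PosSemidef.spectrum_nonneg hK hx
  by_cases h : x = 0
  · simp [h]
  · have : Real.sqrt x ≠ 0 := (Real.sqrt_pos.2 (lt_of_le_of_ne h0 (Ne.symm h))).ne'
    simp [h, this]

theorem kerProj_mul_invSqrtOnSupport (K : Matrix m m ℂ) :
    kerProj K * invSqrtOnSupport K = invSqrtOnSupport K * kerProj K :=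
  cfc_commute_cfc _ _ K

theorem mul_kerProj {K : Matrix m m ℂ} (hK : K.IsHermitian) : K * kerProj K = 0 := by
  have h : K * kerProj K = cfc (fun x : ℝ => x * if x = 0 then 1 else 0) K := by
    rw [cfc_mul (fun x => x) _ K (continuousOn_real_spectrum K _)
      (continuousOn_real_spectrum K _), cfc_id' ℝ K hK.isSelfAdjoint, kerProj]
  rw [h, ← cfc_const_zero ℝ K]
  exact cfc_congr fun x _ => by by_cases h : x = 0 <;> simp [h]

theorem kerProj_mul_of_mul_eq_zero {K W : Matrix m m ℂ} (hK : K.IsHermitian)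
    (h : K * W = 0) : kerProj K * W = W := by
  -- As `0⁻¹ = 0`, the function `x⁻¹` inverts `K` on its support, so the product is the support
  -- projection.
  have h2 : 1 - kerProj K = cfc (fun x : ℝ => x⁻¹) K * K := by
    rw [one_sub_kerProj hK]
    conv_rhs => rhs; rw [← cfc_id' ℝ K hK.isSelfAdjoint]
    rw [← cfc_mul _ _ K (continuousOn_real_spectrum K _) (continuousOn_real_spectrum K _)]
    exact cfc_congr fun x _ => by by_cases h : x = 0 <;> simp [h]
  have h3 : (1 - kerProj K) * W = 0 := by rw [h2, Matrix.mul_assoc, h, Matrix.mul_zero]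
  rw [Matrix.sub_mul, Matrix.one_mul, sub_eq_zero] at h3
  exact h3.symm

/-- Completing the square: `K = S²`, and `v = S T v` because `v` has no component in the kernel, so
the gap is `‖S u - 2 T v‖² / 2`. -/
theorem two_re_sub_le_norm_invSqrt {K : Matrix m m ℂ} (hK : K.PosSemidef) {v : m → ℂ}
    (hv : kerProj K *ᵥ v = 0) (u : m → ℂ) :
    2 * (star u ⬝ᵥ v).re - (star u ⬝ᵥ K *ᵥ u).re / 2
      ≤ 2 * ∑ p, ‖(invSqrtOnSupport K *ᵥ v) p‖ ^ 2 := by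
  set S := cfc Real.sqrt K with hS
  set T := invSqrtOnSupport K with hT
  have hSH : S.IsHermitian := isHermitian_cfc K _
  have hv' : S *ᵥ (T *ᵥ v) = v := by
    rw [mulVec_mulVec, cfc_sqrt_mul_invSqrtOnSupport hK, sub_mulVec, hv, one_mulVec, sub_zero]
  have h1 : star u ⬝ᵥ v = star (S *ᵥ u) ⬝ᵥ (T *ᵥ v) := by
    rw [← star_dotProduct_mulVec_isHermitian hSH, hv']
  have h2 : star u ⬝ᵥ K *ᵥ u = star (S *ᵥ u) ⬝ᵥ (S *ᵥ u) := by
    rw [← star_dotProduct_mulVec_isHermitian hSH, mulVec_mulVec, hS, cfc_sqrt_mul_self hK]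
  have h3 : 0 ≤ (star (S *ᵥ u - (2 : ℂ) • (T *ᵥ v)) ⬝ᵥ (S *ᵥ u - (2 : ℂ) • (T *ᵥ v))).re := by
    rw [re_star_dotProduct_self]; positivity
  have h4 := re_star_dotProduct_comm (T *ᵥ v) (S *ᵥ u)
  rw [← re_star_dotProduct_self, h1, h2]
  simp only [star_sub, star_smul, sub_dotProduct, dotProduct_sub, smul_dotProduct,
    dotProduct_smul, smul_eq_mul, Complex.sub_re, Complex.mul_re, Complex.star_def] at h3
  simp at h3
  linarith

theorem exists_two_re_sub_eq_norm_invSqrt {K : Matrix m m ℂ} (hK : K.PosSemidef) {v : m → ℂ}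
    (hv : kerProj K *ᵥ v = 0) : ∃ u : m → ℂ,
    2 * (star u ⬝ᵥ v).re - (star u ⬝ᵥ K *ᵥ u).re / 2
      = 2 * ∑ p, ‖(invSqrtOnSupport K *ᵥ v) p‖ ^ 2 := by
  set S := cfc Real.sqrt K with hS
  set T := invSqrtOnSupport K with hT
  have hSH : S.IsHermitian := isHermitian_cfc K _
  have hTH : T.IsHermitian := isHermitian_cfc K _
  -- The solution of `S u = 2 T v`, for which the completed square vanishes.
  refine ⟨(2 : ℂ) • (T *ᵥ (T *ᵥ v)), ?_⟩
  have hSu : S *ᵥ ((2 : ℂ) • (T *ᵥ (T *ᵥ v))) = (2 : ℂ) • (T *ᵥ v) := by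
    rw [mulVec_smul, mulVec_mulVec, cfc_sqrt_mul_invSqrtOnSupport hK, sub_mulVec,
      one_mulVec, mulVec_mulVec, hT, kerProj_mul_invSqrtOnSupport, ← mulVec_mulVec, hv,
      mulVec_zero, sub_zero]
  have h2 : ∀ u, star u ⬝ᵥ K *ᵥ u = star (S *ᵥ u) ⬝ᵥ (S *ᵥ u) := fun u => by
    rw [← star_dotProduct_mulVec_isHermitian hSH, mulVec_mulVec, hS, cfc_sqrt_mul_self hK]
  have h1 : star (T *ᵥ (T *ᵥ v)) ⬝ᵥ v = star (T *ᵥ v) ⬝ᵥ (T *ᵥ v) := by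
    rw [star_dotProduct_mulVec_isHermitian hTH]
  rw [h2, hSu, ← re_star_dotProduct_self]
  simp only [star_smul, smul_dotProduct, dotProduct_smul, smul_eq_mul, h1]
  simp
  ring

end Spectral

/-! ### The variational formula for the SLD Fisher information. -/

section Variational

/-- `Matrix.vec` stacks columns, so the entry of `(Wᵀ).vec` at `(i, j)` is `W i j`; this explains
the transposes throughout the section. -/
theorem vec_transpose_surjective {n : Type*} (u : n × n → ℂ) :
    ∃ W : Matrix n n ℂ, u = (Wᵀ).vec :=
  ⟨Matrix.of fun i j => u (i, j), by ext ⟨i, j⟩; rfl⟩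

variable {n : Type*} [Fintype n]

/-- The concave functional of the observable `H` whose supremum is the SLD Fisher information. -/
def sldObj (ρ D H : Matrix n n ℂ) : ℝ := 2 * (D * H).trace.re - (ρ * (H * H)).trace.re

theorem re_trace_mul_mul_conjTranspose_nonneg {ρ : Matrix n n ℂ} (hρ : ρ.PosSemidef)
    (W : Matrix n n ℂ) : 0 ≤ (ρ * (W * Wᴴ)).trace.re := by
  have h := (hρ.conjTranspose_mul_mul_same W).trace_nonneg
  rw [Matrix.mul_assoc, Matrix.trace_mul_comm, Matrix.mul_assoc] at h
  exact (Complex.le_def.1 h).1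

theorem re_trace_mul_sq_nonneg {ρ H : Matrix n n ℂ} (hρ : ρ.PosSemidef) (hH : H.IsHermitian) :
    0 ≤ (ρ * (H * H)).trace.re := by
  simpa [hH.eq] using re_trace_mul_mul_conjTranspose_nonneg hρ H

/-- The positive matrix `Wᴴ ρ W` has trace zero, hence vanishes. Its diagonal entries are the values
of the form `ρ` on the columns of `W`, so `ρ` annihilates every column. -/
theorem mul_eq_zero_of_re_trace_eq_zero {ρ W : Matrix n n ℂ} (hρ : ρ.PosSemidef)
    (h : (ρ * (W * Wᴴ)).trace.re = 0) : ρ * W = 0 := by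
  have h0 := hρ.conjTranspose_mul_mul_same W
  have h1 : (Wᴴ * ρ * W).trace = 0 := by
    refine Complex.ext ?_ ?_
    · rw [Matrix.mul_assoc, Matrix.trace_mul_comm, Matrix.mul_assoc, h, Complex.zero_re]
    · exact (Complex.le_def.1 h0.trace_nonneg).2.symm
  have h2 := h0.trace_eq_zero_iff.1 h1
  ext i j
  have h3 : star (fun k => W k j) ⬝ᵥ ρ *ᵥ (fun k => W k j) = 0 := by
    have := congrFun (congrFun h2 j) j
    rw [Matrix.mul_assoc] at this
    simpa [Matrix.mul_apply, dotProduct, mulVec] using this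
  have := congrFun ((hρ.dotProduct_mulVec_zero_iff _).1 h3) i
  simpa [Matrix.mul_apply, dotProduct, mulVec] using this

theorem star_vec_dotProduct_vec (A B : Matrix n n ℂ) :
    star (Aᵀ).vec ⬝ᵥ (Bᵀ).vec = (Aᴴ * B).trace := by
  simp only [dotProduct, Fintype.sum_prod_type, Matrix.trace, Matrix.diag, Matrix.mul_apply,
    Pi.star_apply, Matrix.vec, Matrix.conjTranspose_apply, Matrix.transpose_apply]
  exact Finset.sum_comm

/-- Passing to the Hermitian part of `W` increases the objective. -/
theorem exists_isHermitian_le_sldObj {ρ D : Matrix n n ℂ} (hρ : ρ.PosSemidef)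
    (hD : D.IsHermitian) (W : Matrix n n ℂ) : ∃ H : Matrix n n ℂ, H.IsHermitian ∧
      2 * (Wᴴ * D).trace.re - ((ρ * (W * Wᴴ)).trace + (ρ * (Wᴴ * W)).trace).re / 2
        ≤ sldObj ρ D H := by
  refine ⟨(2⁻¹ : ℂ) • (W + Wᴴ), ?_, ?_⟩
  · simp [IsHermitian, conjTranspose_smul, add_comm]
  · have h1 : (D * W).trace.re = (Wᴴ * D).trace.re := by
      have : (Wᴴ * D).trace = star (D * W).trace := by
        rw [← trace_conjTranspose, conjTranspose_mul, hD.eq]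
      rw [this]; simp
    -- A quarter of this quantity is exactly the gain from replacing `W` by its Hermitian part.
    have h2 := re_trace_mul_mul_conjTranspose_nonneg hρ (W - Wᴴ)
    simp only [sldObj, Matrix.mul_smul, Matrix.smul_mul, Matrix.trace_smul,
      Matrix.mul_add, Matrix.add_mul, Matrix.mul_sub, Matrix.sub_mul, conjTranspose_sub,
      conjTranspose_conjTranspose, Matrix.trace_add, Matrix.trace_sub, smul_eq_mul,
      Complex.sub_re, Complex.add_re, Complex.mul_re, h1] at h2 ⊢
    rw [Matrix.trace_mul_comm D Wᴴ]
    norm_num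
    linarith

variable [DecidableEq n]

/-- The operator `ρ ⊗ I + I ⊗ ρᵀ`. -/
abbrev anticommOp (ρ : Matrix n n ℂ) : Matrix (n × n) (n × n) ℂ :=
  ρ ⊗ₖ (1 : Matrix n n ℂ) + (1 : Matrix n n ℂ) ⊗ₖ ρᵀ

theorem anticommOp_mulVec_vec (ρ H : Matrix n n ℂ) :
    anticommOp ρ *ᵥ (Hᵀ).vec = ((ρ * H + H * ρ)ᵀ).vec := by
  rw [anticommOp, add_mulVec, kronecker_mulVec_vec, kronecker_mulVec_vec]
  simp [Matrix.transpose_add, Matrix.transpose_mul, Matrix.vec_add]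

theorem kronecker_one_mulVec_gammaVec (D : Matrix n n ℂ) :
    (D ⊗ₖ (1 : Matrix n n ℂ)) *ᵥ gammaVec n = (Dᵀ).vec := by
  have : gammaVec n = (1 : Matrix n n ℂ).vec := by
    ext p; simp [gammaVec, Matrix.vec, Matrix.one_apply, eq_comm]
  rw [this, kronecker_mulVec_vec]; simp

theorem posSemidef_anticommOp {ρ : Matrix n n ℂ} (hρ : ρ.PosSemidef) :
    (anticommOp ρ).PosSemidef :=
  (hρ.kronecker PosSemidef.one).add (PosSemidef.one.kronecker hρ.transpose)

theorem star_vec_dotProduct_anticommOp (ρ H : Matrix n n ℂ) :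
    star (Hᵀ).vec ⬝ᵥ anticommOp ρ *ᵥ (Hᵀ).vec
      = (ρ * (H * Hᴴ)).trace + (ρ * (Hᴴ * H)).trace := by
  rw [anticommOp_mulVec_vec, star_vec_dotProduct_vec, Matrix.mul_add, Matrix.trace_add,
    Matrix.trace_mul_comm, Matrix.mul_assoc, ← Matrix.mul_assoc Hᴴ H,
    Matrix.trace_mul_comm (Hᴴ * H)]

/-- Let `W` be the component of `D` in the kernel of `H ↦ ρ H + H ρ`. The form of this operator at
`W` is a sum of two nonnegative terms, so both vanish and `ρ W = ρ Wᴴ = 0`. Thus `W` lives on the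
kernel of `ρ`, where `D` has no block, and `⟨W, W⟩ = ⟨W, D⟩ = 0`. -/
theorem kerProj_anticommOp_mulVec {ρ D : Matrix n n ℂ} (hρ : ρ.PosSemidef)
    (hD : kerProj ρ * D * kerProj ρ = 0) : kerProj (anticommOp ρ) *ᵥ (Dᵀ).vec = 0 := by
  have hK := posSemidef_anticommOp hρ
  set Q := kerProj (anticommOp ρ) with hQ
  have hQH : Q.IsHermitian := isHermitian_cfc _ _
  obtain ⟨W, hW⟩ := vec_transpose_surjective (Q *ᵥ (Dᵀ).vec)
  have hKW : anticommOp ρ *ᵥ (Wᵀ).vec = 0 := by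
    rw [← hW, mulVec_mulVec, hQ, mul_kerProj hK.isHermitian, zero_mulVec]
  have h0 := star_vec_dotProduct_anticommOp ρ W
  rw [hKW, dotProduct_zero] at h0
  have h1 := re_trace_mul_mul_conjTranspose_nonneg hρ W
  have h2 := re_trace_mul_mul_conjTranspose_nonneg hρ Wᴴ
  rw [conjTranspose_conjTranspose] at h2
  have h3 := congrArg Complex.re h0
  rw [Complex.zero_re, Complex.add_re] at h3
  have hW1 := mul_eq_zero_of_re_trace_eq_zero hρ (W := W) (by linarith)
  have hW2 := mul_eq_zero_of_re_trace_eq_zero hρ (W := Wᴴ)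
    (by rw [conjTranspose_conjTranspose]; linarith)
  have hP : (kerProj ρ)ᴴ = kerProj ρ := isHermitian_cfc _ _
  have e1 := kerProj_mul_of_mul_eq_zero hρ.isHermitian hW1
  have e2 := kerProj_mul_of_mul_eq_zero hρ.isHermitian hW2
  have hQQ : Q * Q = Q := by
    refine kerProj_mul_of_mul_eq_zero hK.isHermitian (mul_kerProj hK.isHermitian)
  have h4 : star (Wᵀ).vec ⬝ᵥ (Wᵀ).vec = 0 := by
    calc star (Wᵀ).vec ⬝ᵥ (Wᵀ).vec = star (Wᵀ).vec ⬝ᵥ (Dᵀ).vec := by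
          rw [← hW, ← star_dotProduct_mulVec_isHermitian hQH, mulVec_mulVec, hQQ,
            star_dotProduct_mulVec_isHermitian hQH]
      _ = (Wᴴ * D).trace := star_vec_dotProduct_vec W D
      _ = ((kerProj ρ * Wᴴ) * (kerProj ρ * D)).trace := by
          rw [e2]
          nth_rewrite 1 [← e1]
          rw [conjTranspose_mul, hP, Matrix.mul_assoc]
      _ = 0 := by
          rw [Matrix.trace_mul_comm, ← Matrix.mul_assoc, hD, Matrix.zero_mul, Matrix.trace_zero]
  rw [hW]
  exact dotProduct_star_self_eq_zero.1 h4

theorem ofReal_sldObj_le_sldInfo {ρ D H : Matrix n n ℂ} (hρ : ρ.PosSemidef)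
    (hH : H.IsHermitian) : ENNReal.ofReal (sldObj ρ D H) ≤ sldInfo ρ D := by
  unfold sldInfo
  split_ifs with h
  · refine ENNReal.ofReal_le_ofReal ?_
    have := two_re_sub_le_norm_invSqrt (posSemidef_anticommOp hρ)
      (kerProj_anticommOp_mulVec hρ h) (Hᵀ).vec
    rw [star_vec_dotProduct_anticommOp, star_vec_dotProduct_vec, hH.eq] at this
    rw [kronecker_one_mulVec_gammaVec]
    refine le_trans (le_of_eq ?_) this
    rw [sldObj, Matrix.trace_mul_comm D H, Complex.add_re]; ring
  · exact le_top

theorem sldInfo_le_of_forall {ρ D : Matrix n n ℂ} (hρ : ρ.PosSemidef) (hD : D.IsHermitian)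
    {c : ℝ≥0∞} (hc : ∀ H : Matrix n n ℂ, H.IsHermitian → ENNReal.ofReal (sldObj ρ D H) ≤ c) :
    sldInfo ρ D ≤ c := by
  unfold sldInfo
  split_ifs with h
  · rw [kronecker_one_mulVec_gammaVec]
    obtain ⟨u, hu⟩ := exists_two_re_sub_eq_norm_invSqrt (posSemidef_anticommOp hρ)
      (kerProj_anticommOp_mulVec hρ h)
    obtain ⟨W, rfl⟩ := vec_transpose_surjective u
    rw [star_vec_dotProduct_anticommOp, star_vec_dotProduct_vec] at hu
    obtain ⟨H, hH, hle⟩ := exists_isHermitian_le_sldObj hρ hD W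
    rw [← hu]
    exact (ENNReal.ofReal_le_ofReal hle).trans (hc H hH)
  -- In the infinite case the kernel block `W = Q D Q` is nonzero. Along its multiples the quadratic
  -- penalty is zero while the linear term is unbounded.
  · set Q := kerProj ρ
    have hQ : Qᴴ = Q := isHermitian_cfc _ _
    set W := Q * D * Q with hWdef
    have hWH : W.IsHermitian := by
      rw [IsHermitian, hWdef, conjTranspose_mul, conjTranspose_mul, hQ, hD.eq, Matrix.mul_assoc]
    have hρW : ρ * W = 0 := by
      rw [hWdef, ← Matrix.mul_assoc, ← Matrix.mul_assoc, mul_kerProj hρ.isHermitian,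
        Matrix.zero_mul, Matrix.zero_mul]
    have hQQ : Q * Q = Q :=
      kerProj_mul_of_mul_eq_zero hρ.isHermitian (mul_kerProj hρ.isHermitian)
    have hDW : (D * W).trace = (Wᴴ * W).trace := by
      rw [hWH.eq, hWdef]
      calc (D * (Q * D * Q)).trace = (D * (Q * Q * D * (Q * Q))).trace := by rw [hQQ]
        _ = ((D * Q) * (Q * D * Q * Q)).trace := by simp only [Matrix.mul_assoc]
        _ = (((D * Q) * (Q * D * Q)) * Q).trace := by simp only [Matrix.mul_assoc]
        _ = _ := by rw [Matrix.trace_mul_comm]; simp only [Matrix.mul_assoc]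
    have hpos : 0 < (Wᴴ * W).trace.re := by
      have h0 := (posSemidef_conjTranspose_mul_self W).trace_nonneg
      have h1 := Complex.le_def.1 h0
      refine lt_of_le_of_ne h1.1 fun h2 => h ?_
      exact trace_conjTranspose_mul_self_eq_zero_iff.1 (Complex.ext h2.symm h1.2.symm)
    refine le_of_eq (Eq.symm (ENNReal.eq_top_of_forall_nnreal_le fun r => ?_))
    -- The factor is chosen so that the objective takes the value `r` exactly.
    have hH : (((r / (2 * (Wᴴ * W).trace.re) : ℝ) : ℂ) • W).IsHermitian := by
      rw [IsHermitian, conjTranspose_smul, hWH.eq, Complex.star_def, Complex.conj_ofReal]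
    refine le_trans (le_of_eq ?_) (hc _ hH)
    have hρWW : ρ * (W * W) = 0 := by rw [← Matrix.mul_assoc, hρW, Matrix.zero_mul]
    simp only [sldObj, Matrix.smul_mul, Matrix.mul_smul, hρWW]
    rw [Matrix.trace_smul, hDW, smul_eq_mul, Complex.re_ofReal_mul]
    have : 2 * (↑r / (2 * (Wᴴ * W).trace.re) * (Wᴴ * W).trace.re) = (r : ℝ) := by
      field_simp
    simp [this]

/-- The variational form of the bounds on the SLD Fisher information by a real constant. -/
theorem sldInfo_le_ofReal_iff {ρ D : Matrix n n ℂ} (hρ : ρ.PosSemidef) (hD : D.IsHermitian)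
    {c : ℝ} (hc : 0 ≤ c) : sldInfo ρ D ≤ ENNReal.ofReal c ↔
      ∀ H : Matrix n n ℂ, H.IsHermitian → sldObj ρ D H ≤ c :=
  ⟨fun h _ hH => (ENNReal.ofReal_le_ofReal_iff hc).1 ((ofReal_sldObj_le_sldInfo hρ hH).trans h),
    fun h => sldInfo_le_of_forall hρ hD fun H hH => ENNReal.ofReal_le_ofReal (h H hH)⟩

end Variational

end CQ

namespace CQ

/-! ### Elementary properties of the objective; relabelling of bases. -/

section Objective

variable {n : Type*} [Fintype n]

theorem sldObj_zero (ρ D : Matrix n n ℂ) : sldObj ρ D 0 = 0 := by simp [sldObj]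

theorem sldObj_sum {ι : Type*} (s : Finset ι) (ρ D : ι → Matrix n n ℂ) (H : Matrix n n ℂ) :
    sldObj (∑ x ∈ s, ρ x) (∑ x ∈ s, D x) H = ∑ x ∈ s, sldObj (ρ x) (D x) H := by
  simp only [sldObj, Finset.sum_mul, Matrix.trace_sum, Complex.re_sum, Finset.mul_sum,
    Finset.sum_sub_distrib]

theorem trace_mul_submatrix_symm {m : Type*} [Fintype m] (e : m ≃ n) (M : Matrix n n ℂ)
    (H : Matrix m m ℂ) :
    (M.submatrix e e * H).trace = (M * H.submatrix e.symm e.symm).trace := by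
  have : M.submatrix e e * H = (M * H.submatrix e.symm e.symm).submatrix e e := by
    rw [← Matrix.submatrix_mul_equiv _ _ e e e, Matrix.submatrix_submatrix]; simp
  rw [this]
  exact e.sum_comp fun i => (M * H.submatrix e.symm e.symm) i i

theorem sldObj_submatrix {m : Type*} [Fintype m] (e : m ≃ n) (ρ D : Matrix n n ℂ)
    (H : Matrix m m ℂ) :
    sldObj (ρ.submatrix e e) (D.submatrix e e) H
      = sldObj ρ D (H.submatrix e.symm e.symm) := by
  rw [sldObj, sldObj, trace_mul_submatrix_symm, trace_mul_submatrix_symm,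
    Matrix.submatrix_mul_equiv]

theorem sldInfo_submatrix_le {m : Type*} [Fintype m] [DecidableEq n] [DecidableEq m] (e : m ≃ n)
    {ρ D : Matrix n n ℂ} (hρ : ρ.PosSemidef) (hD : D.IsHermitian) :
    sldInfo (ρ.submatrix e e) (D.submatrix e e) ≤ sldInfo ρ D :=
  sldInfo_le_of_forall (hρ.submatrix e) (hD.submatrix e) fun H hH => by
    rw [sldObj_submatrix]
    exact ofReal_sldObj_le_sldInfo hρ (hH.submatrix e.symm)

theorem sldInfo_submatrix {m : Type*} [Fintype m] [DecidableEq n] [DecidableEq m] (e : m ≃ n)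
    {ρ D : Matrix n n ℂ} (hρ : ρ.PosSemidef) (hD : D.IsHermitian) :
    sldInfo (ρ.submatrix e e) (D.submatrix e e) = sldInfo ρ D := by
  refine le_antisymm (sldInfo_submatrix_le e hρ hD) ?_
  simpa using sldInfo_submatrix_le e.symm (hρ.submatrix e) (hD.submatrix e)

theorem sldInfo_zero_right [DecidableEq n] {ρ : Matrix n n ℂ} (hρ : ρ.PosSemidef) :
    sldInfo ρ 0 = 0 := by
  refine le_antisymm (sldInfo_le_of_forall hρ Matrix.isHermitian_zero fun H hH => ?_) bot_le
  rw [ENNReal.ofReal_eq_zero.2]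
  simpa [sldObj] using re_trace_mul_sq_nonneg hρ hH

theorem trace_mul_im_eq_zero {A H : Matrix n n ℂ} (hA : A.IsHermitian) (hH : H.IsHermitian) :
    (A * H).trace.im = 0 := by
  have h : star (A * H).trace = (A * H).trace := by
    rw [← trace_conjTranspose, conjTranspose_mul, hA.eq, hH.eq, Matrix.trace_mul_comm]
  exact Complex.conj_eq_iff_im.1 h

end Objective

/-! ### The trace adjoint of a linear map. -/

section TraceAdjoint

variable {m n : Type*} [Fintype n] [DecidableEq m]

/-- The adjoint of a linear map of matrix spaces for the pairing `Tr[M N]`. -/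
def traceAdj (Φ : Matrix m m ℂ →ₗ[ℂ] Matrix n n ℂ) (H : Matrix n n ℂ) : Matrix m m ℂ :=
  Matrix.of fun a b => (Φ (Matrix.single b a 1) * H).trace

theorem map_eq_sum_single {n : Type*} [Fintype m] (Φ : Matrix m m ℂ →ₗ[ℂ] Matrix n n ℂ) (M : Matrix m m ℂ) :
    Φ M = ∑ a, ∑ b, M a b • Φ (Matrix.single a b 1) := by
  conv_lhs => rw [Matrix.matrix_eq_sum_single M]
  simp only [map_sum]
  refine Finset.sum_congr rfl fun a _ => Finset.sum_congr rfl fun b _ => ?_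
  rw [← map_smul, Matrix.smul_single, smul_eq_mul, mul_one]

theorem trace_map_mul [Fintype m] (Φ : Matrix m m ℂ →ₗ[ℂ] Matrix n n ℂ) (M : Matrix m m ℂ)
    (H : Matrix n n ℂ) : (Φ M * H).trace = (M * traceAdj Φ H).trace := by
  rw [map_eq_sum_single Φ M]
  simp only [Finset.sum_mul, Matrix.trace_sum, Matrix.smul_mul, Matrix.trace_smul, smul_eq_mul]
  simp only [Matrix.trace, Matrix.diag, Matrix.mul_apply, traceAdj, Matrix.of_apply]

theorem isHermitian_traceAdj {Φ : Matrix m m ℂ →ₗ[ℂ] Matrix n n ℂ}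
    (hΦ : ∀ a b, Φ (Matrix.single a b 1) = (Φ (Matrix.single b a 1))ᴴ) {H : Matrix n n ℂ}
    (hH : H.IsHermitian) : (traceAdj Φ H).IsHermitian := by
  ext a b
  rw [conjTranspose_apply, traceAdj, Matrix.of_apply, Matrix.of_apply, ← trace_conjTranspose,
    conjTranspose_mul, hH.eq, ← hΦ, Matrix.trace_mul_comm]

end TraceAdjoint

/-! ### Kadison's inequality and data processing. -/

section Channel

theorem trace_conjTranspose_mul_mul_prod {ι B : Type*} [Fintype B] [Fintype ι] (c : ι → Matrix B B ℂ)
    (P : Matrix (ι × B) (ι × B) ℂ) :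
    ((Matrix.of fun (p : ι × B) b => c p.1 p.2 b)ᴴ * P
        * (Matrix.of fun (p : ι × B) b => c p.1 p.2 b)).trace
      = ∑ i, ∑ j, ((c i)ᴴ * (Matrix.of fun b b' => P (i, b) (j, b')) * c j).trace := by
  simp only [Matrix.trace, Matrix.diag, Matrix.mul_apply, Fintype.sum_prod_type,
    conjTranspose_apply, Matrix.of_apply, Finset.sum_mul]
  trans ∑ b, ∑ j, ∑ i, ∑ b', ∑ b'', star (c i b'' b) * P (i, b'') (j, b') * c j b' b
  · exact Finset.sum_congr rfl fun b _ => Finset.sum_congr rfl fun j _ => Finset.sum_comm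
  · symm
    rw [Finset.sum_comm]
    trans ∑ j, ∑ b, ∑ i, ∑ b', ∑ b'', star (c i b'' b) * P (i, b'') (j, b') * c j b' b
    · exact Finset.sum_congr rfl fun j _ => Finset.sum_comm
    · exact Finset.sum_comm

variable {A B : Type*} [Fintype A] [Fintype B] {Φ : Matrix A A ℂ →ₗ[ℂ] Matrix B B ℂ}

theorem IsChannel.map_posSemidef (hΦ : IsChannel Φ) {M : Matrix A A ℂ} (hM : M.PosSemidef) :
    (Φ M).PosSemidef := by
  have h := hΦ.1 1 (M.submatrix Prod.snd Prod.snd) (hM.submatrix _)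
  exact h.submatrix (fun b => ((0 : Fin 1), b))

theorem IsChannel.map_isDensity (hΦ : IsChannel Φ) {M : Matrix A A ℂ} (hM : IsDensity M) :
    IsDensity (Φ M) :=
  ⟨hΦ.map_posSemidef hM.1, by rw [hΦ.2, hM.2]⟩

variable [DecidableEq A]

/-- Two-positivity suffices: the projector onto `|0,a⟩ + |1,b⟩` has the matrix units of `(a, b)` and
`(b, a)` as off-diagonal blocks, and its image under `id ⊗ Φ` is Hermitian. -/
theorem IsChannel.map_single_eq_conjTranspose (hΦ : IsChannel Φ) (a b : A) :
    Φ (Matrix.single a b 1) = (Φ (Matrix.single b a 1))ᴴ := by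
  let v : Fin 2 × A → ℂ := fun p => if p.2 = ![a, b] p.1 then 1 else 0
  have hM := (hΦ.1 2 _ (posSemidef_vecMulVec_self_star v)).isHermitian
  have key : ∀ i j : Fin 2, (Matrix.of fun c c' => vecMulVec v (star v) (i, c) (j, c'))
      = Matrix.single (![a, b] i) (![a, b] j) (1 : ℂ) := by
    intro i j
    ext c c'
    simp only [Matrix.of_apply, vecMulVec_apply, Pi.star_apply, v, Matrix.single_apply]
    by_cases h1 : c = ![a, b] i <;> by_cases h2 : c' = ![a, b] j <;>
      simp [h1, h2, eq_comm]
  ext p q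
  have h := hM.apply (0, p) (1, q)
  simp only [ampl, Matrix.of_apply, key] at h
  simpa [conjTranspose_apply] using h.symm

theorem IsChannel.map_isHermitian (hΦ : IsChannel Φ) {M : Matrix A A ℂ} (hM : M.IsHermitian) :
    (Φ M).IsHermitian := by
  rw [map_eq_sum_single Φ M, IsHermitian]
  simp only [conjTranspose_sum, conjTranspose_smul, ← hΦ.map_single_eq_conjTranspose]
  rw [Finset.sum_comm]
  simp only [hM.apply]

/-- Kadison's inequality for the adjoint of a channel, in the state `ρ`. -/
theorem IsChannel.re_trace_traceAdj_sq_le [DecidableEq B] (hΦ : IsChannel Φ) {ρ : Matrix A A ℂ}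
    (hρ : ρ.PosSemidef) {H : Matrix B B ℂ} (hH : H.IsHermitian) :
    (ρ * (traceAdj Φ H * traceAdj Φ H)).trace.re ≤ (Φ ρ * (H * H)).trace.re := by
  set G := traceAdj Φ H with hGdef
  have hG : G.IsHermitian := isHermitian_traceAdj hΦ.map_single_eq_conjTranspose hH
  -- The block matrix `V ρ Vᴴ` with column `V = (G, -1)` is positive, hence so is its image under
  -- `id ⊗ Φ`. Compressing by the column `(1, H)` and taking the trace gives `Tr[ρ G²] - 2 Tr[ρ G²]
  -- + Tr[Φ(ρ) H²] ≥ 0`.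
  let g : Fin 2 → Matrix A A ℂ := ![G, -1]
  let c : Fin 2 → Matrix B B ℂ := ![1, H]
  let V : Matrix (Fin 2 × A) A ℂ := Matrix.of fun p a => g p.1 p.2 a
  have hM := hρ.mul_mul_conjTranspose_same V
  have hb : ∀ i j, (Matrix.of fun a a' => (V * ρ * Vᴴ) (i, a) (j, a')) = g i * ρ * (g j)ᴴ := by
    intro i j
    ext a a'
    simp [Matrix.mul_apply, V]
  have h := ((hΦ.1 2 _ hM).conjTranspose_mul_mul_same
    (Matrix.of fun (p : Fin 2 × B) b => c p.1 p.2 b)).trace_nonneg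
  rw [trace_conjTranspose_mul_mul_prod] at h
  have h' : ∀ i j, (Matrix.of fun b b' => ampl (Fin 2) Φ (V * ρ * Vᴴ) (i, b) (j, b'))
      = Φ (g i * ρ * (g j)ᴴ) := by
    intro i j
    rw [← hb]
    rfl
  simp only [h', Fin.sum_univ_two] at h
  have h2 := (Complex.le_def.1 h).1
  simp only [g, c, Matrix.cons_val_zero, Matrix.cons_val_one, conjTranspose_one, hH.eq, hG.eq,
    Matrix.one_mul, Matrix.mul_one, Matrix.neg_mul, Matrix.mul_neg, conjTranspose_neg, map_neg,
    neg_neg, Matrix.trace_neg] at h2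
  have e1 : (Φ (G * ρ * G)).trace = (ρ * (G * G)).trace := by
    rw [hΦ.2, Matrix.mul_assoc, Matrix.trace_mul_comm, Matrix.mul_assoc]
  have e2 : (Φ (G * ρ) * H).trace = (ρ * (G * G)).trace := by
    rw [trace_map_mul, ← hGdef, Matrix.trace_mul_comm, ← Matrix.mul_assoc,
      Matrix.trace_mul_comm]
  have e3 : (H * Φ (ρ * G)).trace = (ρ * (G * G)).trace := by
    rw [Matrix.trace_mul_comm, trace_map_mul, ← hGdef, Matrix.mul_assoc]
  have e4 : (H * Φ ρ * H).trace = (Φ ρ * (H * H)).trace := by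
    rw [Matrix.mul_assoc, Matrix.trace_mul_comm, Matrix.mul_assoc]
  simp only [Complex.add_re, Complex.neg_re, Complex.zero_re, e1, e2, e3, e4] at h2
  linarith

/-- Data processing for the SLD Fisher information. -/
theorem IsChannel.sldInfo_map_le [DecidableEq B] (hΦ : IsChannel Φ) {ρ D : Matrix A A ℂ} (hρ : ρ.PosSemidef)
    (hD : D.IsHermitian) : sldInfo (Φ ρ) (Φ D) ≤ sldInfo ρ D := by
  refine sldInfo_le_of_forall (hΦ.map_posSemidef hρ) (hΦ.map_isHermitian hD) fun H hH => ?_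
  refine le_trans (ENNReal.ofReal_le_ofReal ?_) (ofReal_sldObj_le_sldInfo hρ
    (isHermitian_traceAdj hΦ.map_single_eq_conjTranspose hH))
  rw [sldObj, sldObj, trace_map_mul]
  linarith [hΦ.re_trace_traceAdj_sq_le hρ hH]

end Channel

end CQ

namespace CQ

/-! ### Product states: chain inequality and additivity. -/

section Kronecker

/-- The linear map `σ ↦ σ ⊗ ω`. -/
def kronRight (R : Type*) {B : Type*} (ω : Matrix B B ℂ) :
    Matrix R R ℂ →ₗ[ℂ] Matrix (R × B) (R × B) ℂ where
  toFun σ := σ ⊗ₖ ω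
  map_add' σ τ := add_kronecker σ τ ω
  map_smul' c σ := smul_kronecker c σ ω

/-- The linear map `ω ↦ σ ⊗ ω`. -/
def kronLeft {R : Type*} (B : Type*) (σ : Matrix R R ℂ) :
    Matrix B B ℂ →ₗ[ℂ] Matrix (R × B) (R × B) ℂ where
  toFun ω := σ ⊗ₖ ω
  map_add' ω τ := kronecker_add σ ω τ
  map_smul' c ω := kronecker_smul c σ ω

theorem isHermitian_kronecker {R B : Type*} {σ : Matrix R R ℂ} {ω : Matrix B B ℂ}
    (hσ : σ.IsHermitian) (hω : ω.IsHermitian) : (σ ⊗ₖ ω).IsHermitian := by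
  rw [IsHermitian, conjTranspose_kronecker, hσ.eq, hω.eq]

variable {R B : Type*} [Fintype R] [Fintype B]

theorem trace_kronecker_mul_eq_right [DecidableEq R] (σ : Matrix R R ℂ) (ω : Matrix B B ℂ)
    (H : Matrix (R × B) (R × B) ℂ) :
    ((σ ⊗ₖ ω) * H).trace = (σ * traceAdj (kronRight R ω) H).trace :=
  trace_map_mul (kronRight R ω) σ H

theorem trace_kronecker_mul_eq_left [DecidableEq B] (σ : Matrix R R ℂ) (ω : Matrix B B ℂ)
    (H : Matrix (R × B) (R × B) ℂ) :
    ((σ ⊗ₖ ω) * H).trace = (ω * traceAdj (kronLeft B σ) H).trace :=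
  trace_map_mul (kronLeft B σ) ω H

theorem isHermitian_traceAdj_kronRight [DecidableEq R] {ω : Matrix B B ℂ} (hω : ω.IsHermitian)
    {H : Matrix (R × B) (R × B) ℂ} (hH : H.IsHermitian) :
    (traceAdj (kronRight R ω) H).IsHermitian :=
  isHermitian_traceAdj (fun a b => by
    simp only [kronRight, LinearMap.coe_mk, AddHom.coe_mk]
    rw [conjTranspose_kronecker, hω.eq, conjTranspose_single, star_one]) hH

theorem isHermitian_traceAdj_kronLeft [DecidableEq B] {σ : Matrix R R ℂ} (hσ : σ.IsHermitian)
    {H : Matrix (R × B) (R × B) ℂ} (hH : H.IsHermitian) :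
    (traceAdj (kronLeft B σ) H).IsHermitian :=
  isHermitian_traceAdj (fun a b => by
    simp only [kronLeft, LinearMap.coe_mk, AddHom.coe_mk]
    rw [conjTranspose_kronecker, hσ.eq, conjTranspose_single, star_one]) hH

variable [DecidableEq R] [DecidableEq B]

theorem trace_im_eq_zero {A : Matrix R R ℂ} (hA : A.IsHermitian) : A.trace.im = 0 := by
  simpa using trace_mul_im_eq_zero hA Matrix.isHermitian_one

/-- A fixed tensor factor `σ` multiplies the objective by at most `Tr σ`. -/
theorem sldObj_kronecker_left_le {σ : Matrix R R ℂ} {ω W : Matrix B B ℂ} (hσ : σ.PosSemidef)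
    (hω : ω.PosSemidef) {c : ℝ} (hc : ∀ K : Matrix B B ℂ, K.IsHermitian → sldObj ω W K ≤ c)
    {H : Matrix (R × B) (R × B) ℂ} (hH : H.IsHermitian) :
    sldObj (σ ⊗ₖ ω) (σ ⊗ₖ W) H ≤ σ.trace.re * c := by
  have hs0 : 0 ≤ σ.trace.re := (Complex.le_def.1 hσ.trace_nonneg).1
  have hsC : σ.trace = (σ.trace.re : ℂ) :=
    Complex.ext rfl (by rw [trace_im_eq_zero hσ.isHermitian, Complex.ofReal_im])
  rcases hs0.eq_or_lt with h0 | hs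
  · have : σ = 0 := hσ.trace_eq_zero_iff.1 (by rw [hsC, ← h0, Complex.ofReal_zero])
    simp [this, sldObj]
  set s := σ.trace.re with hsdef
  set K := traceAdj (kronLeft B σ) H with hK
  have hKH : K.IsHermitian := isHermitian_traceAdj_kronLeft hσ.isHermitian hH
  -- `K` is the partial trace `Tr_R[(σ ⊗ 1) H]`, so `L` is the conditional expectation of `H` in the
  -- normalized state `σ / s`. Positivity of `(H - 1 ⊗ L)²` gives `Tr[(σ ⊗ ω) H²] ≥ s Tr[ω L²]`.
  set L := ((s⁻¹ : ℝ) : ℂ) • K with hL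
  have hLH : L.IsHermitian := by
    rw [IsHermitian, hL, conjTranspose_smul, hKH.eq, Complex.star_def, Complex.conj_ofReal]
  have hLK : K = (s : ℂ) • L := by
    rw [hL, smul_smul, ← Complex.ofReal_mul, mul_inv_cancel₀ hs.ne', Complex.ofReal_one, one_smul]
  have e1 : ((σ ⊗ₖ ω) * (H * (1 ⊗ₖ L))).trace = (s : ℂ) * (ω * (L * L)).trace := by
    rw [← Matrix.mul_assoc, Matrix.trace_mul_comm, ← Matrix.mul_assoc, ← mul_kronecker_mul,
      Matrix.one_mul, trace_kronecker_mul_eq_left, ← hK, hLK, Matrix.mul_smul, Matrix.trace_smul,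
      Matrix.mul_assoc, Matrix.trace_mul_comm, Matrix.mul_assoc, smul_eq_mul]
  have e2 : ((σ ⊗ₖ ω) * ((1 ⊗ₖ L) * H)).trace = (s : ℂ) * (ω * (L * L)).trace := by
    rw [← Matrix.mul_assoc, ← mul_kronecker_mul,
      Matrix.mul_one, trace_kronecker_mul_eq_left, ← hK, hLK, Matrix.mul_smul, Matrix.trace_smul,
      Matrix.mul_assoc, smul_eq_mul]
  have e3 : ((σ ⊗ₖ ω) * ((1 ⊗ₖ L) * ((1 : Matrix R R ℂ) ⊗ₖ L))).trace
      = (s : ℂ) * (ω * (L * L)).trace := by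
    rw [← mul_kronecker_mul, ← mul_kronecker_mul, trace_kronecker, Matrix.mul_one,
      Matrix.mul_one, hsC]
  have e4 : ((σ ⊗ₖ W) * H).trace = (s : ℂ) * (W * L).trace := by
    rw [trace_kronecker_mul_eq_left, ← hK, hLK, Matrix.mul_smul, Matrix.trace_smul, smul_eq_mul]
  have hpos := re_trace_mul_sq_nonneg (hσ.kronecker hω)
    (hH.sub (isHermitian_kronecker (Matrix.isHermitian_one (n := R)) hLH))
  simp only [Matrix.sub_mul, Matrix.mul_sub, Matrix.trace_sub, Complex.sub_re] at hpos
  rw [e1, e2, e3] at hpos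
  have hcL := mul_le_mul_of_nonneg_left (hc L hLH) hs.le
  rw [sldObj] at hcL ⊢
  rw [e4]
  simp only [Complex.re_ofReal_mul] at hpos ⊢
  linarith

/-- The chain inequality for a product of two states. -/
theorem sldObj_kronecker_le {σ τ : Matrix R R ℂ} {ω W : Matrix B B ℂ} (hσ : σ.PosSemidef)
    (hω : IsDensity ω) (hW : W.trace = 0) {c : ℝ}
    (hc : ∀ K : Matrix B B ℂ, K.IsHermitian → sldObj ω W K ≤ c)
    {H : Matrix (R × B) (R × B) ℂ} (hH : H.IsHermitian) :
    sldObj (σ ⊗ₖ ω) (τ ⊗ₖ ω + σ ⊗ₖ W) H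
      ≤ sldObj σ τ (traceAdj (kronRight R ω) H) + σ.trace.re * c := by
  set G := traceAdj (kronRight R ω) H with hG
  have hGH : G.IsHermitian := isHermitian_traceAdj_kronRight hω.1.isHermitian hH
  -- The remainder `H - G ⊗ 1` is orthogonal to `G ⊗ 1` in the state `σ ⊗ ω`, so the second moments
  -- subtract; since `Tr W = 0`, the term `G ⊗ 1` is invisible to `σ ⊗ W`.
  have key := sldObj_kronecker_left_le hσ hω.1 hc
    (hH.sub (isHermitian_kronecker hGH (Matrix.isHermitian_one (n := B))))
  have e1 : ((σ ⊗ₖ ω) * (H * (G ⊗ₖ 1))).trace = (σ * (G * G)).trace := by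
    rw [← Matrix.mul_assoc, Matrix.trace_mul_comm, ← Matrix.mul_assoc, ← mul_kronecker_mul,
      Matrix.one_mul, trace_kronecker_mul_eq_right, ← hG,
      Matrix.mul_assoc, Matrix.trace_mul_comm, Matrix.mul_assoc]
  have e2 : ((σ ⊗ₖ ω) * ((G ⊗ₖ 1) * H)).trace = (σ * (G * G)).trace := by
    rw [← Matrix.mul_assoc, ← mul_kronecker_mul,
      Matrix.mul_one, trace_kronecker_mul_eq_right, ← hG, Matrix.mul_assoc]
  have e3 : ((σ ⊗ₖ ω) * ((G ⊗ₖ 1) * (G ⊗ₖ (1 : Matrix B B ℂ)))).trace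
      = (σ * (G * G)).trace := by
    rw [← mul_kronecker_mul, ← mul_kronecker_mul, trace_kronecker, Matrix.mul_one,
      Matrix.mul_one, hω.2, mul_one]
  have e4 : ((σ ⊗ₖ W) * (G ⊗ₖ (1 : Matrix B B ℂ))).trace = 0 := by
    rw [← mul_kronecker_mul, trace_kronecker, Matrix.mul_one, hW, mul_zero]
  have e5 : ((τ ⊗ₖ ω) * H).trace = (τ * G).trace := trace_kronecker_mul_eq_right τ ω H
  simp only [sldObj, Matrix.sub_mul, Matrix.mul_sub, Matrix.trace_sub, Complex.sub_re, e1, e2,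
    e3, e4, Complex.zero_re, Matrix.add_mul, Matrix.trace_add, Complex.add_re, e5] at key ⊢
  linarith

/-- The cross term in the second moment is `2 Tr[ρ G] Tr[ω K]`, so centering one of the two
observables is enough. -/
theorem sldObj_kronecker_add {ρ D : Matrix R R ℂ} {ω W : Matrix B B ℂ} (hρ : ρ.trace = 1)
    (hω : ω.trace = 1) (hD : D.trace = 0) (hW : W.trace = 0) {G : Matrix R R ℂ}
    {K : Matrix B B ℂ} (hG : (ρ * G).trace = 0) :
    sldObj (ρ ⊗ₖ ω) (D ⊗ₖ ω + ρ ⊗ₖ W) (G ⊗ₖ 1 + 1 ⊗ₖ K) = sldObj ρ D G + sldObj ω W K := by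
  simp only [sldObj, Matrix.mul_add, Matrix.add_mul, ← mul_kronecker_mul, Matrix.trace_add, trace_kronecker, hρ, hω, hD, hW, hG, mul_one, one_mul,
    zero_mul, mul_zero, add_zero, zero_add, Complex.add_re]
  ring

/-- Subtracting the expectation value of an observable increases the objective. -/
theorem exists_centered_le_sldObj {ρ D : Matrix R R ℂ} (hρ : IsDensity ρ) (hD : D.trace = 0)
    {H : Matrix R R ℂ} (hH : H.IsHermitian) : ∃ G : Matrix R R ℂ, G.IsHermitian ∧
      (ρ * G).trace = 0 ∧ max 0 (sldObj ρ D H) ≤ sldObj ρ D G := by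
  -- A negative value is replaced by that of the zero observable, so that `ENNReal.ofReal` becomes
  -- additive on the values obtained.
  rcases le_total (sldObj ρ D H) 0 with h | h
  · exact ⟨0, Matrix.isHermitian_zero, by simp, by rw [max_eq_left h, sldObj_zero]⟩
  set r := (ρ * H).trace.re with hr
  have hrC : (ρ * H).trace = (r : ℂ) :=
    Complex.ext rfl (by rw [trace_mul_im_eq_zero hρ.1.isHermitian hH, Complex.ofReal_im])
  refine ⟨H - (r : ℂ) • 1, ?_, ?_, ?_⟩
  · refine hH.sub ?_
    rw [IsHermitian, conjTranspose_smul, conjTranspose_one, Complex.star_def,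
      Complex.conj_ofReal]
  · simp [Matrix.mul_sub, hrC, hρ.2]
  · rw [max_eq_right h]
    simp only [sldObj, Matrix.mul_sub, Matrix.sub_mul, Matrix.mul_smul, Matrix.smul_mul,
      Matrix.one_mul, Matrix.trace_sub, Matrix.trace_smul, hrC, hρ.2, hD,
      Complex.sub_re, smul_eq_mul, mul_zero, mul_one, Complex.zero_re, Complex.re_ofReal_mul,
      Complex.ofReal_re]
    nlinarith [sq_nonneg r]

/-- Additivity of the SLD Fisher information for product states. -/
theorem sldInfo_kronecker {ρ D : Matrix R R ℂ} {ω W : Matrix B B ℂ} (hρ : IsDensity ρ)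
    (hω : IsDensity ω) (hDH : D.IsHermitian) (hWH : W.IsHermitian) (hD : D.trace = 0)
    (hW : W.trace = 0) :
    sldInfo (ρ ⊗ₖ ω) (D ⊗ₖ ω + ρ ⊗ₖ W) = sldInfo ρ D + sldInfo ω W := by
  have hP := hρ.1.kronecker hω.1
  have hQ := (isHermitian_kronecker hDH hω.1.isHermitian).add
    (isHermitian_kronecker hρ.1.isHermitian hWH)
  refine le_antisymm ?_ ?_
  · by_cases htop : sldInfo ω W = ⊤
    · simp [htop]
    have hc := (sldInfo_le_ofReal_iff hω.1 hWH ENNReal.toReal_nonneg).1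
      (ENNReal.ofReal_toReal htop).ge
    refine sldInfo_le_of_forall hP hQ fun H hH => ?_
    have h := sldObj_kronecker_le (τ := D) hρ.1 hω hW hc hH
    rw [hρ.2, Complex.one_re, one_mul] at h
    refine (ENNReal.ofReal_le_ofReal h).trans (ENNReal.ofReal_add_le.trans ?_)
    rw [ENNReal.ofReal_toReal htop]
    gcongr
    exact ofReal_sldObj_le_sldInfo hρ.1 (isHermitian_traceAdj_kronRight hω.1.isHermitian hH)
  · have key : ∀ G : Matrix R R ℂ, G.IsHermitian → ∀ K : Matrix B B ℂ, K.IsHermitian →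
        ENNReal.ofReal (sldObj ρ D G) + ENNReal.ofReal (sldObj ω W K)
          ≤ sldInfo (ρ ⊗ₖ ω) (D ⊗ₖ ω + ρ ⊗ₖ W) := by
      intro G hG K hK
      obtain ⟨G', hG', hG0, hGle⟩ := exists_centered_le_sldObj hρ hD hG
      obtain ⟨K', hK', -, hKle⟩ := exists_centered_le_sldObj hω hW hK
      have h := ofReal_sldObj_le_sldInfo (D := D ⊗ₖ ω + ρ ⊗ₖ W) hP
        ((isHermitian_kronecker hG' (Matrix.isHermitian_one (n := B))).add
          (isHermitian_kronecker (Matrix.isHermitian_one (n := R)) hK'))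
      rw [sldObj_kronecker_add hρ.2 hω.2 hD hW hG0,
        ENNReal.ofReal_add ((le_max_left _ _).trans hGle) ((le_max_left _ _).trans hKle)] at h
      refine le_trans (add_le_add ?_ ?_) h
      · exact ENNReal.ofReal_le_ofReal ((le_max_right _ _).trans hGle)
      · exact ENNReal.ofReal_le_ofReal ((le_max_right _ _).trans hKle)
    -- The two suprema are taken one after the other, moving the finite other summand across by
    -- subtraction.
    have step1 : ∀ G : Matrix R R ℂ, G.IsHermitian → ENNReal.ofReal (sldObj ρ D G)
        + sldInfo ω W ≤ sldInfo (ρ ⊗ₖ ω) (D ⊗ₖ ω + ρ ⊗ₖ W) := by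
      intro G hG
      rw [add_comm]
      have h0 : ENNReal.ofReal (sldObj ρ D G) ≤ sldInfo (ρ ⊗ₖ ω) (D ⊗ₖ ω + ρ ⊗ₖ W) :=
        le_self_add.trans (key G hG 0 Matrix.isHermitian_zero)
      refine (ENNReal.le_sub_iff_add_le_right ENNReal.ofReal_ne_top h0).1 ?_
      refine sldInfo_le_of_forall hω.1 hWH fun K hK => ?_
      exact ENNReal.le_sub_of_add_le_left ENNReal.ofReal_ne_top (key G hG K hK)
    by_cases htop : sldInfo ω W = ⊤
    · refine le_trans ?_ (step1 0 Matrix.isHermitian_zero)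
      simp [htop]
    refine (ENNReal.le_sub_iff_add_le_right htop ?_).1 ?_
    · exact le_add_self.trans (step1 0 Matrix.isHermitian_zero)
    · exact sldInfo_le_of_forall hρ.1 hDH fun G hG =>
        ENNReal.le_sub_of_add_le_right htop (step1 G hG)

end Kronecker

/-! ### The chain inequality for classical-quantum channels. -/

section ClassicalQuantum

variable {R X B : Type*} [Fintype R] [Fintype X] [Fintype B]

theorem ampl_cqChannel {R B : Type*} (ω : X → Matrix B B ℂ) (M : Matrix (R × X) (R × X) ℂ) :
    ampl R (cqChannel ω) M = ∑ x, blockDiag M x ⊗ₖ ω x := by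
  ext p q
  simp [ampl, cqChannel, Matrix.sum_apply, kroneckerMap_apply, blockDiag_apply]

theorem isDensity_ampl_cqChannel {ω : X → Matrix B B ℂ} (hω : ∀ x, IsDensity (ω x))
    {ρ : Matrix (R × X) (R × X) ℂ} (hρ : IsDensity ρ) :
    IsDensity (ampl R (cqChannel ω) ρ) := by
  rw [ampl_cqChannel]
  constructor
  · exact posSemidef_sum _ fun x _ => (hρ.1.submatrix _).kronecker (hω x).1
  · simp only [Matrix.trace_sum, trace_kronecker, (hω _).2, mul_one]
    rw [← hρ.2, Matrix.trace, Fintype.sum_prod_type, Finset.sum_comm]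
    rfl

variable [DecidableEq X]

theorem trace_mul_blockDiagonal (D : Matrix (R × X) (R × X) ℂ) (G : X → Matrix R R ℂ) :
    (D * blockDiagonal G).trace = ∑ x, (blockDiag D x * G x).trace := by
  simp only [Matrix.trace, Matrix.diag, Matrix.mul_apply, Fintype.sum_prod_type,
    blockDiagonal_apply, blockDiag_apply]
  rw [Finset.sum_comm]
  simp

/-- A block-diagonal observable sees only the diagonal blocks of the state, so the input need not be
dephased beforehand. -/
theorem sldObj_blockDiagonal (ρ D : Matrix (R × X) (R × X) ℂ) (G : X → Matrix R R ℂ) :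
    sldObj ρ D (blockDiagonal G) = ∑ x, sldObj (blockDiag ρ x) (blockDiag D x) (G x) := by
  simp only [sldObj, ← blockDiagonal_mul, trace_mul_blockDiagonal, Complex.re_sum,
    Finset.mul_sum, Finset.sum_sub_distrib]

variable [DecidableEq R] [DecidableEq B]

/-- The chain inequality behind the amortization collapse of classical-quantum channels. -/
theorem sldInfo_cq_le {ρ D : Matrix (R × X) (R × X) ℂ} (hρ : IsDensity ρ) (hD : D.IsHermitian)
    {ω W : X → Matrix B B ℂ} (hω : ∀ x, IsDensity (ω x)) (hWH : ∀ x, (W x).IsHermitian)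
    (hW : ∀ x, (W x).trace = 0) :
    sldInfo (∑ x, blockDiag ρ x ⊗ₖ ω x) (∑ x, (blockDiag D x ⊗ₖ ω x + blockDiag ρ x ⊗ₖ W x))
      ≤ sldInfo ρ D + ⨆ x, sldInfo (ω x) (W x) := by
  have hρx : ∀ x, (blockDiag ρ x).PosSemidef := fun x => hρ.1.submatrix _
  have hDx : ∀ x, (blockDiag D x).IsHermitian := fun x => hD.submatrix _
  by_cases htop : (⨆ x, sldInfo (ω x) (W x)) = ⊤
  · simp [htop]
  set c := (⨆ x, sldInfo (ω x) (W x)).toReal with hc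
  have hcx : ∀ x, ∀ K : Matrix B B ℂ, K.IsHermitian → sldObj (ω x) (W x) K ≤ c := fun x =>
    (sldInfo_le_ofReal_iff (hω x).1 (hWH x) ENNReal.toReal_nonneg).1
      (by rw [ENNReal.ofReal_toReal htop]; exact le_iSup (fun x => sldInfo (ω x) (W x)) x)
  refine sldInfo_le_of_forall (posSemidef_sum _ fun x _ => (hρx x).kronecker (hω x).1) ?_
    fun H hH => ?_
  · rw [IsHermitian, conjTranspose_sum]
    exact Finset.sum_congr rfl fun x _ =>
      ((isHermitian_kronecker (hDx x) (hω x).1.isHermitian).add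
        (isHermitian_kronecker (hρx x).isHermitian (hWH x))).eq
  -- The conditional expectations of `H`, one for each letter, assembled into a single observable on
  -- `R ⊗ X`.
  set G : X → Matrix R R ℂ := fun x => traceAdj (kronRight R (ω x)) H
  have hG : (blockDiagonal G).IsHermitian := by
    rw [IsHermitian, blockDiagonal_conjTranspose]
    congr 1
    ext1 x
    exact isHermitian_traceAdj_kronRight (hω x).1.isHermitian hH
  have htr : ∑ x, (blockDiag ρ x).trace.re = 1 := by
    rw [← Complex.re_sum, ← Complex.one_re, ← hρ.2, Matrix.trace, Fintype.sum_prod_type,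
      Finset.sum_comm]
    rfl
  have h : sldObj (∑ x, blockDiag ρ x ⊗ₖ ω x)
      (∑ x, (blockDiag D x ⊗ₖ ω x + blockDiag ρ x ⊗ₖ W x)) H
        ≤ sldObj ρ D (blockDiagonal G) + c := by
    rw [sldObj_sum, sldObj_blockDiagonal]
    calc _ ≤ ∑ x, (sldObj (blockDiag ρ x) (blockDiag D x) (G x) + (blockDiag ρ x).trace.re * c) :=
          Finset.sum_le_sum fun x _ => sldObj_kronecker_le (hρx x) (hω x) (hW x) (hcx x) hH
      _ = _ := by rw [Finset.sum_add_distrib, ← Finset.sum_mul, htr, one_mul]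
  refine (ENNReal.ofReal_le_ofReal h).trans (ENNReal.ofReal_add_le.trans ?_)
  rw [hc, ENNReal.ofReal_toReal htop]
  gcongr
  exact ofReal_sldObj_le_sldInfo hρ.1 hG

end ClassicalQuantum

end CQ

namespace CQ

/-! ### Differentiable matrix families. -/

section Derivative

variable {m n : Type*} {Θ : Set ℝ} {θ : ℝ}

/-- Entrywise differentiability of a matrix family within `Θ`, with derivative `D`. -/
def HasMatDeriv (Θ : Set ℝ) (ρ : ℝ → Matrix n n ℂ) (D : Matrix n n ℂ) (θ : ℝ) : Prop :=
  ∀ i j, HasDerivWithinAt (fun t => ρ t i j) (D i j) Θ θ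

namespace HasMatDeriv

variable {ρ : ℝ → Matrix n n ℂ} {D : Matrix n n ℂ}

theorem matDeriv_eq (h : HasMatDeriv Θ ρ D θ) (hu : UniqueDiffWithinAt ℝ Θ θ) :
    matDeriv Θ ρ θ = D := by
  ext i j
  exact (h i j).derivWithin hu

theorem isHermitian (h : HasMatDeriv Θ ρ D θ) (hu : UniqueDiffWithinAt ℝ Θ θ) (hθ : θ ∈ Θ)
    (hρ : ∀ t ∈ Θ, (ρ t).IsHermitian) : D.IsHermitian := by
  ext i j
  rw [conjTranspose_apply]
  refine hu.eq_deriv Θ ?_ (h i j)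
  exact (h j i).star.congr (fun t ht => ((hρ t ht).apply i j).symm) ((hρ θ hθ).apply i j).symm

theorem trace_eq_zero [Fintype n] (h : HasMatDeriv Θ ρ D θ) (hu : UniqueDiffWithinAt ℝ Θ θ)
    (hθ : θ ∈ Θ) (hρ : ∀ t ∈ Θ, (ρ t).trace = 1) : D.trace = 0 := by
  have h1 : HasDerivWithinAt (fun t => (ρ t).trace) D.trace Θ θ :=
    HasDerivWithinAt.fun_sum fun i _ => h i i
  exact hu.eq_deriv Θ h1 ((hasDerivWithinAt_const θ Θ (1 : ℂ)).congr hρ (hρ θ hθ))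

theorem submatrix (h : HasMatDeriv Θ ρ D θ) (e : m → n) :
    HasMatDeriv Θ (fun t => (ρ t).submatrix e e) (D.submatrix e e) θ := fun i j => h (e i) (e j)

theorem kronecker {ω : ℝ → Matrix m m ℂ} {W : Matrix m m ℂ} (h : HasMatDeriv Θ ρ D θ)
    (hω : HasMatDeriv Θ ω W θ) :
    HasMatDeriv Θ (fun t => ρ t ⊗ₖ ω t) (D ⊗ₖ ω θ + ρ θ ⊗ₖ W) θ := fun i j =>
  (h i.1 j.1).mul (hω i.2 j.2)

theorem sum {ι : Type*} {s : Finset ι} {ρ : ι → ℝ → Matrix n n ℂ} {D : ι → Matrix n n ℂ}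
    (h : ∀ x ∈ s, HasMatDeriv Θ (ρ x) (D x) θ) :
    HasMatDeriv Θ (fun t => ∑ x ∈ s, ρ x t) (∑ x ∈ s, D x) θ := fun i j => by
  simp only [Matrix.sum_apply]
  exact HasDerivWithinAt.fun_sum fun x hx => h x hx i j

theorem map [Fintype n] [DecidableEq n] (h : HasMatDeriv Θ ρ D θ)
    (Φ : Matrix n n ℂ →ₗ[ℂ] Matrix m m ℂ) : HasMatDeriv Θ (fun t => Φ (ρ t)) (Φ D) θ := by
  have hΦ : (fun t => Φ (ρ t)) = fun t => ∑ a, ∑ b, ρ t a b • Φ (Matrix.single a b 1) := by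
    ext1 t
    exact map_eq_sum_single Φ (ρ t)
  rw [hΦ, map_eq_sum_single Φ D]
  refine sum fun a _ => sum fun b _ => fun i j => ?_
  exact (h a b).mul_const _

end HasMatDeriv

variable [Fintype m] [Fintype n]

theorem isDiffStateFamily_iff {ρ : ℝ → Matrix n n ℂ} : IsDiffStateFamily Θ ρ ↔
    (∀ t ∈ Θ, IsDensity (ρ t)) ∧ ∀ t ∈ Θ, ∃ D, HasMatDeriv Θ ρ D t := by
  refine and_congr_right fun _ => ⟨fun h t ht => ?_, fun h i j t ht => ?_⟩
  · exact ⟨matDeriv Θ ρ t, fun i j => (h i j t ht).hasDerivWithinAt⟩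
  · obtain ⟨D, hD⟩ := h t ht
    exact (hD i j).differentiableWithinAt

theorem isDiffStateFamily_const {ρ : Matrix n n ℂ} (hρ : IsDensity ρ) :
    IsDiffStateFamily Θ (fun _ => ρ) :=
  ⟨fun _ _ => hρ, fun _ _ => differentiableOn_const _⟩

namespace IsDiffStateFamily

variable {ρ : ℝ → Matrix n n ℂ} {ω : ℝ → Matrix m m ℂ}

theorem hasMatDeriv (h : IsDiffStateFamily Θ ρ) (hθ : θ ∈ Θ) :
    HasMatDeriv Θ ρ (matDeriv Θ ρ θ) θ := fun i j => (h.2 i j θ hθ).hasDerivWithinAt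

theorem isHermitian_matDeriv (h : IsDiffStateFamily Θ ρ) (hu : UniqueDiffWithinAt ℝ Θ θ)
    (hθ : θ ∈ Θ) : (matDeriv Θ ρ θ).IsHermitian :=
  (h.hasMatDeriv hθ).isHermitian hu hθ fun t ht => (h.1 t ht).1.isHermitian

theorem trace_matDeriv (h : IsDiffStateFamily Θ ρ) (hu : UniqueDiffWithinAt ℝ Θ θ)
    (hθ : θ ∈ Θ) : (matDeriv Θ ρ θ).trace = 0 :=
  (h.hasMatDeriv hθ).trace_eq_zero hu hθ fun t ht => (h.1 t ht).2

theorem kronecker (h : IsDiffStateFamily Θ ρ) (hω : IsDiffStateFamily Θ ω) :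
    IsDiffStateFamily Θ (fun t => ρ t ⊗ₖ ω t) :=
  isDiffStateFamily_iff.2 ⟨fun t ht => ⟨(h.1 t ht).1.kronecker (hω.1 t ht).1, by
    rw [trace_kronecker, (h.1 t ht).2, (hω.1 t ht).2, one_mul]⟩,
    fun _ ht => ⟨_, (h.hasMatDeriv ht).kronecker (hω.hasMatDeriv ht)⟩⟩

theorem submatrix (h : IsDiffStateFamily Θ ρ) (e : m ≃ n) :
    IsDiffStateFamily Θ (fun t => (ρ t).submatrix e e) :=
  isDiffStateFamily_iff.2 ⟨fun t ht => ⟨(h.1 t ht).1.submatrix e,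
    (e.sum_comp fun i => ρ t i i).trans (h.1 t ht).2⟩,
    fun _ ht => ⟨_, (h.hasMatDeriv ht).submatrix e⟩⟩

theorem map [DecidableEq n] (h : IsDiffStateFamily Θ ρ) {Φ : Matrix n n ℂ →ₗ[ℂ] Matrix m m ℂ}
    (hΦ : IsChannel Φ) : IsDiffStateFamily Θ (fun t => Φ (ρ t)) :=
  isDiffStateFamily_iff.2 ⟨fun t ht => hΦ.map_isDensity (h.1 t ht),
    fun _ ht => ⟨_, (h.hasMatDeriv ht).map Φ⟩⟩

variable [DecidableEq n] [DecidableEq m]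

theorem sldFisher_const {ρ : Matrix n n ℂ} (hρ : ρ.PosSemidef) :
    sldFisher Θ (fun _ => ρ) θ = 0 := by
  have h : matDeriv Θ (fun _ => ρ) θ = 0 := by ext i j; simp [matDeriv]
  rw [sldFisher, h, sldInfo_zero_right hρ]

theorem sldFisher_kronecker (h : IsDiffStateFamily Θ ρ) (hω : IsDiffStateFamily Θ ω)
    (hu : UniqueDiffWithinAt ℝ Θ θ) (hθ : θ ∈ Θ) :
    sldFisher Θ (fun t => ρ t ⊗ₖ ω t) θ = sldFisher Θ ρ θ + sldFisher Θ ω θ := by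
  rw [sldFisher, ((h.hasMatDeriv hθ).kronecker (hω.hasMatDeriv hθ)).matDeriv_eq hu,
    sldInfo_kronecker (h.1 θ hθ) (hω.1 θ hθ) (h.isHermitian_matDeriv hu hθ)
      (hω.isHermitian_matDeriv hu hθ) (h.trace_matDeriv hu hθ) (hω.trace_matDeriv hu hθ)]
  rfl

theorem sldFisher_submatrix (h : IsDiffStateFamily Θ ρ) (e : m ≃ n)
    (hu : UniqueDiffWithinAt ℝ Θ θ) (hθ : θ ∈ Θ) :
    sldFisher Θ (fun t => (ρ t).submatrix e e) θ = sldFisher Θ ρ θ := by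
  rw [sldFisher, ((h.hasMatDeriv hθ).submatrix e).matDeriv_eq hu,
    sldInfo_submatrix e (h.1 θ hθ).1 (h.isHermitian_matDeriv hu hθ)]
  rfl

theorem sldFisher_map_le (h : IsDiffStateFamily Θ ρ) {Φ : Matrix n n ℂ →ₗ[ℂ] Matrix m m ℂ}
    (hΦ : IsChannel Φ) (hu : UniqueDiffWithinAt ℝ Θ θ) (hθ : θ ∈ Θ) :
    sldFisher Θ (fun t => Φ (ρ t)) θ ≤ sldFisher Θ ρ θ := by
  rw [sldFisher, ((h.hasMatDeriv hθ).map Φ).matDeriv_eq hu]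
  exact hΦ.sldInfo_map_le (h.1 θ hθ).1 (h.isHermitian_matDeriv hu hθ)

end IsDiffStateFamily

end Derivative

/-! ### One use of a classical-quantum channel; the amortization collapse. -/

section CqFamily

variable {R X B : Type*} [Fintype R] [Fintype X] [Fintype B] {Θ : Set ℝ} {θ : ℝ}
  {ω : ℝ → X → Matrix B B ℂ}

theorem hasMatDeriv_ampl_cqChannel {ρ : ℝ → Matrix (R × X) (R × X) ℂ}
    (hω : ∀ x, IsDiffStateFamily Θ (fun t => ω t x)) (hρ : IsDiffStateFamily Θ ρ) (hθ : θ ∈ Θ) :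
    HasMatDeriv Θ (fun t => ampl R (cqChannel (ω t)) (ρ t))
      (∑ x, (blockDiag (matDeriv Θ ρ θ) x ⊗ₖ ω θ x
        + blockDiag (ρ θ) x ⊗ₖ matDeriv Θ (fun t => ω t x) θ)) θ := by
  simp only [ampl_cqChannel]
  exact HasMatDeriv.sum fun x _ =>
    ((hρ.hasMatDeriv hθ).submatrix (fun r => (r, x))).kronecker ((hω x).hasMatDeriv hθ)

theorem isDiffStateFamily_ampl_cqChannel {ρ : ℝ → Matrix (R × X) (R × X) ℂ}
    (hω : ∀ x, IsDiffStateFamily Θ (fun t => ω t x)) (hρ : IsDiffStateFamily Θ ρ) :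
    IsDiffStateFamily Θ (fun t => ampl R (cqChannel (ω t)) (ρ t)) :=
  isDiffStateFamily_iff.2
    ⟨fun t ht => isDensity_ampl_cqChannel (fun x => (hω x).1 t ht) (hρ.1 t ht),
      fun _ ht => ⟨_, hasMatDeriv_ampl_cqChannel hω hρ ht⟩⟩

variable [DecidableEq X]

theorem ampl_cqChannel_kronecker_single {R B : Type*} (ω : X → Matrix B B ℂ) (σ : Matrix R R ℂ)
    (x : X) : ampl R (cqChannel ω) (σ ⊗ₖ Matrix.single x x (1 : ℂ)) = σ ⊗ₖ ω x := by
  ext p q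
  rw [ampl_cqChannel, Matrix.sum_apply, Finset.sum_eq_single x]
  · simp [kroneckerMap_apply, blockDiag_apply]
  · intro y _ hy
    simp [kroneckerMap_apply, blockDiag_apply, hy.symm]
  · simp

theorem isDensity_single (x : X) : IsDensity (Matrix.single x x (1 : ℂ)) := by
  refine ⟨?_, Matrix.trace_single_eq_same x 1⟩
  rw [← Matrix.diagonal_single]
  exact PosSemidef.diagonal fun i => by by_cases h : i = x <;> simp [h]

theorem IsDensity.kronecker {ρ : Matrix R R ℂ} {σ : Matrix B B ℂ} (hρ : IsDensity ρ)
    (hσ : IsDensity σ) : IsDensity (ρ ⊗ₖ σ) :=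
  ⟨hρ.1.kronecker hσ.1, by rw [trace_kronecker, hρ.2, hσ.2, one_mul]⟩

theorem isDensity_one_fin : IsDensity (1 : Matrix (Fin 1) (Fin 1) ℂ) :=
  ⟨PosSemidef.one, by simp⟩

variable [DecidableEq B]

/-- One use of a classical-quantum channel increases the Fisher information by at most the
largest Fisher information of its output states. -/
theorem sldFisher_ampl_cqChannel_le [DecidableEq R] {ρ : ℝ → Matrix (R × X) (R × X) ℂ}
    (hω : ∀ x, IsDiffStateFamily Θ (fun t => ω t x)) (hρ : IsDiffStateFamily Θ ρ)
    (hu : UniqueDiffWithinAt ℝ Θ θ) (hθ : θ ∈ Θ) :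
    sldFisher Θ (fun t => ampl R (cqChannel (ω t)) (ρ t)) θ
      ≤ sldFisher Θ ρ θ + ⨆ x, sldFisher Θ (fun t => ω t x) θ := by
  rw [sldFisher, (hasMatDeriv_ampl_cqChannel hω hρ hθ).matDeriv_eq hu, ampl_cqChannel]
  exact sldInfo_cq_le (hρ.1 θ hθ) (hρ.isHermitian_matDeriv hu hθ) (fun x => (hω x).1 θ hθ)
    (fun x => (hω x).isHermitian_matDeriv hu hθ) (fun x => (hω x).trace_matDeriv hu hθ)

theorem sldFisher_ampl_cqChannel_single
    (hω : ∀ x, IsDiffStateFamily Θ (fun t => ω t x)) (hu : UniqueDiffWithinAt ℝ Θ θ)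
    (hθ : θ ∈ Θ) (x : X) :
    sldFisher Θ (fun t => ampl (Fin 1) (cqChannel (ω t))
      ((1 : Matrix (Fin 1) (Fin 1) ℂ) ⊗ₖ Matrix.single x x (1 : ℂ))) θ
      = sldFisher Θ (fun t => ω t x) θ := by
  simp only [ampl_cqChannel_kronecker_single]
  rw [(isDiffStateFamily_const isDensity_one_fin).sldFisher_kronecker (hω x) hu hθ,
    IsDiffStateFamily.sldFisher_const PosSemidef.one, zero_add]

/-- A fixed input has zero information, so the chain inequality is the upper bound; basis inputs
`|x⟩⟨x|` give the lower bound. -/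
theorem channelFisher_cqChannel (hω : ∀ x, IsDiffStateFamily Θ (fun t => ω t x))
    (hu : UniqueDiffWithinAt ℝ Θ θ) (hθ : θ ∈ Θ) :
    channelFisher Θ (fun t => cqChannel (ω t)) θ = ⨆ x, sldFisher Θ (fun t => ω t x) θ := by
  refine le_antisymm (iSup_le fun r => iSup_le fun ρ => iSup_le fun hρ => ?_)
    (iSup_le fun x => ?_)
  · have h := sldFisher_ampl_cqChannel_le hω (isDiffStateFamily_const hρ) hu hθ
    rwa [IsDiffStateFamily.sldFisher_const hρ.1, zero_add] at h
  · rw [← sldFisher_ampl_cqChannel_single hω hu hθ x]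
    exact le_iSup_of_le 1 (le_iSup_of_le _ (le_iSup_of_le
      (isDensity_one_fin.kronecker (isDensity_single x)) le_rfl))

theorem amortizedFisher_cqChannel [Nonempty X] (hω : ∀ x, IsDiffStateFamily Θ (fun t => ω t x))
    (hu : UniqueDiffWithinAt ℝ Θ θ) (hθ : θ ∈ Θ) :
    amortizedFisher Θ (fun t => cqChannel (ω t)) θ
      = ((⨆ x, sldFisher Θ (fun t => ω t x) θ : ℝ≥0∞) : EReal) := by
  refine le_antisymm (iSup_le fun r => iSup_le fun ρ => iSup_le fun hρ => ?_) ?_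
  · refine EReal.sub_le_of_le_add ?_
    rw [← EReal.coe_ennreal_add, EReal.coe_ennreal_le_coe_ennreal_iff, add_comm]
    exact sldFisher_ampl_cqChannel_le hω hρ hu hθ
  -- The constant input family at an optimal letter has nothing to subtract.
  · obtain ⟨x, hx⟩ := exists_eq_ciSup_of_finite (f := fun x => sldFisher Θ (fun t => ω t x) θ)
    have hd := isDensity_one_fin.kronecker (isDensity_single x)
    refine le_iSup_of_le 1 (le_iSup_of_le _ (le_iSup_of_le (isDiffStateFamily_const hd) ?_))
    rw [IsDiffStateFamily.sldFisher_const hd.1, sldFisher_ampl_cqChannel_single hω hu hθ x, ← hx]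
    simp

end CqFamily

/-! ### Tensor powers and parallel strategies. -/

section Parallel

variable {B : Type*}

/-- The tensor product of finitely many matrices on the same space. -/
def piKron {n : ℕ} (ω : Fin n → Matrix B B ℂ) : Matrix (Fin n → B) (Fin n → B) ℂ :=
  Matrix.of fun b b' => ∏ i, ω i (b i) (b' i)

theorem piKron_succ {n : ℕ} (ω : Fin (n + 1) → Matrix B B ℂ) :
    piKron ω = (ω 0 ⊗ₖ piKron fun i : Fin n => ω i.succ).submatrix
      (Fin.consEquiv fun _ => B).symm (Fin.consEquiv fun _ => B).symm := by
  ext b b'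
  simp only [piKron, Matrix.of_apply, Fin.prod_univ_succ, submatrix_apply, kroneckerMap_apply]
  rfl

/-- A matrix unit of two different words is killed at a coordinate where they differ. The power is
thus classical-quantum with the words of length `n` as alphabet, and the one-use theorem applies to
it. -/
theorem tensorPow_cqChannel {X : Type*} [Fintype X] [DecidableEq X] (n : ℕ)
    (ω : X → Matrix B B ℂ) :
    tensorPow n (cqChannel ω) = cqChannel fun a : Fin n → X => piKron fun i => ω (a i) := by
  have hs : ∀ a a' : X, cqChannel ω (Matrix.single a a' 1) = if a = a' then ω a else 0 := by
    intro a a'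
    by_cases h : a = a'
    · subst h
      change ∑ x, _ = _
      rw [Finset.sum_eq_single a (fun y _ hy => by simp [hy.symm]) (by simp)]
      simp
    · have : ∀ x, ¬ (a = x ∧ a' = x) := fun x hx => h (hx.1.trans hx.2.symm)
      simp [cqChannel, h, this]
  refine LinearMap.ext fun M => ?_
  ext b b'
  simp only [tensorPow, LinearMap.coe_mk, AddHom.coe_mk, Matrix.of_apply, hs]
  simp only [cqChannel, LinearMap.coe_mk, AddHom.coe_mk, Matrix.sum_apply, Matrix.smul_apply,
    smul_eq_mul]
  refine Finset.sum_congr rfl fun a _ => ?_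
  rw [Finset.sum_eq_single a]
  · simp [piKron]
  · intro a' _ ha
    obtain ⟨i, hi⟩ := Function.ne_iff.1 ha
    rw [Finset.prod_eq_zero (Finset.mem_univ i), mul_zero]
    simp [Ne.symm hi]
  · simp

variable [Fintype B] [DecidableEq B] {Θ : Set ℝ} {θ : ℝ}

theorem isDiffStateFamily_piKron {n : ℕ} {ω : Fin n → ℝ → Matrix B B ℂ}
    (hω : ∀ i, IsDiffStateFamily Θ (ω i)) :
    IsDiffStateFamily Θ (fun t => piKron fun i => ω i t) := by
  induction n with
  | zero =>
    have : (fun t => piKron fun i => ω i t) = fun _ => 1 := by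
      ext t b b'
      simp [piKron, Matrix.one_apply, Subsingleton.elim b b']
    rw [this]
    exact isDiffStateFamily_const ⟨PosSemidef.one, by simp⟩
  | succ n ih =>
    simp only [piKron_succ]
    exact ((hω 0).kronecker (ih fun i => hω i.succ)).submatrix _

theorem sldFisher_piKron {n : ℕ} {ω : Fin n → ℝ → Matrix B B ℂ}
    (hω : ∀ i, IsDiffStateFamily Θ (ω i)) (hu : UniqueDiffWithinAt ℝ Θ θ) (hθ : θ ∈ Θ) :
    sldFisher Θ (fun t => piKron fun i => ω i t) θ = ∑ i, sldFisher Θ (ω i) θ := by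
  induction n with
  | zero =>
    have : (fun t => piKron fun i => ω i t) = fun _ => 1 := by
      ext t b b'
      simp [piKron, Matrix.one_apply, Subsingleton.elim b b']
    rw [this, IsDiffStateFamily.sldFisher_const PosSemidef.one]
    simp
  | succ n ih =>
    simp only [piKron_succ]
    have h := isDiffStateFamily_piKron fun i : Fin n => hω i.succ
    rw [((hω 0).kronecker h).sldFisher_submatrix _ hu hθ, (hω 0).sldFisher_kronecker h hu hθ,
      ih fun i => hω i.succ, Fin.sum_univ_succ]

theorem channelFisher_tensorPow_cqChannel {X : Type*} [Fintype X] [DecidableEq X] [Nonempty X]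
    {ω : ℝ → X → Matrix B B ℂ} (hω : ∀ x, IsDiffStateFamily Θ (fun t => ω t x))
    (hu : UniqueDiffWithinAt ℝ Θ θ) (hθ : θ ∈ Θ) (n : ℕ) :
    channelFisher Θ (fun t => tensorPow n (cqChannel (ω t))) θ
      = (n : ℝ≥0∞) * ⨆ x, sldFisher Θ (fun t => ω t x) θ := by
  simp only [tensorPow_cqChannel]
  rw [channelFisher_cqChannel (ω := fun t (a : Fin n → X) => piKron fun i => ω t (a i))
    (fun a => isDiffStateFamily_piKron (ω := fun i t => ω t (a i)) fun i => hω (a i)) hu hθ]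
  have h : ∀ a : Fin n → X, sldFisher Θ (fun t => piKron fun i => ω t (a i)) θ
      = ∑ i, sldFisher Θ (fun t => ω t (a i)) θ := fun a =>
    sldFisher_piKron (ω := fun i t => ω t (a i)) (fun i => hω (a i)) hu hθ
  simp only [h]
  refine le_antisymm (iSup_le fun a => ?_) ?_
  · calc _ ≤ ∑ _i : Fin n, ⨆ x, sldFisher Θ (fun t => ω t x) θ :=
          Finset.sum_le_sum fun i _ => le_iSup (fun x => sldFisher Θ (fun t => ω t x) θ) (a i)
      _ = _ := by simp
  · obtain ⟨x, hx⟩ := exists_eq_ciSup_of_finite (f := fun x => sldFisher Θ (fun t => ω t x) θ)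
    refine le_iSup_of_le (fun _ => x) ?_
    rw [← hx]
    simp

end Parallel

/-! ### Sequential strategies. -/

section Sequential

variable {X B : Type*} [Fintype X] [Fintype B] [DecidableEq B]
  {Θ : Set ℝ} {θ : ℝ} {ω : ℝ → X → Matrix B B ℂ}

theorem SeqStrategy.isDiffStateFamily_output (S : SeqStrategy X B)
    (hω : ∀ x, IsDiffStateFamily Θ (fun t => ω t x)) (k : ℕ) :
    IsDiffStateFamily Θ (fun t => S.output (cqChannel (ω t)) k) := by
  induction k with
  | zero => exact isDiffStateFamily_ampl_cqChannel hω (isDiffStateFamily_const S.init_isDensity)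
  | succ k ih => exact isDiffStateFamily_ampl_cqChannel hω (ih.map (S.step_isChannel k))

variable [DecidableEq X]

/-- Interleaved channels cannot increase the information, by data processing, and each use adds at
most the supremum. -/
theorem SeqStrategy.sldFisher_output_le (S : SeqStrategy X B)
    (hω : ∀ x, IsDiffStateFamily Θ (fun t => ω t x)) (hu : UniqueDiffWithinAt ℝ Θ θ)
    (hθ : θ ∈ Θ) (k : ℕ) :
    sldFisher Θ (fun t => S.output (cqChannel (ω t)) k) θ
      ≤ ((k + 1 : ℕ) : ℝ≥0∞) * ⨆ x, sldFisher Θ (fun t => ω t x) θ := by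
  induction k with
  | zero =>
    have h := sldFisher_ampl_cqChannel_le hω (isDiffStateFamily_const S.init_isDensity) hu hθ
    rw [IsDiffStateFamily.sldFisher_const S.init_isDensity.1, zero_add] at h
    rwa [zero_add, Nat.cast_one, one_mul]
  | succ k ih =>
    have hk := S.isDiffStateFamily_output hω k
    refine (sldFisher_ampl_cqChannel_le hω (hk.map (S.step_isChannel k)) hu hθ).trans ?_
    have := (hk.sldFisher_map_le (S.step_isChannel k) hu hθ).trans ih
    calc _ ≤ ((k + 1 : ℕ) : ℝ≥0∞) * (⨆ x, sldFisher Θ (fun t => ω t x) θ)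
          + ⨆ x, sldFisher Θ (fun t => ω t x) θ := by gcongr
      _ = _ := by push_cast; ring

/-- The channel that appends the pure state `|x⟩⟨x|`, after a relabelling of the input. -/
def appendSingle {m n : Type*} (e : m ≃ n) (x : X) :
    Matrix n n ℂ →ₗ[ℂ] Matrix (m × X) (m × X) ℂ :=
  kronRight m (Matrix.single x x (1 : ℂ)) ∘ₗ
    (Matrix.reindexLinearEquiv ℂ ℂ e.symm e.symm).toLinearMap

theorem appendSingle_apply {X m n : Type*} [DecidableEq X] (e : m ≃ n) (x : X) (M : Matrix n n ℂ) :
    appendSingle e x M = M.submatrix e e ⊗ₖ Matrix.single x x (1 : ℂ) := rfl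

theorem isChannel_appendSingle {m n : Type*} [Fintype m] [Fintype n] (e : m ≃ n) (x : X) :
    IsChannel (appendSingle e x) := by
  constructor
  · intro r M hM
    have : ampl (Fin r) (appendSingle e x) M = (M ⊗ₖ Matrix.single x x (1 : ℂ)).submatrix
        (fun p => ((p.1, e p.2.1), p.2.2)) (fun p => ((p.1, e p.2.1), p.2.2)) := rfl
    rw [this]
    exact (hM.kronecker (isDensity_single x).1).submatrix _
  · intro M
    rw [appendSingle_apply, trace_kronecker, Matrix.trace_single_eq_same, mul_one]
    exact e.sum_comp fun i => M i i

/-- Dimension of a memory that stores `k` systems of dimension `b`. -/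
def memDim (b : ℕ) : ℕ → ℕ
  | 0 => 1
  | k + 1 => memDim b k * b

/-- The strategy that always sends `x` and keeps all the channel outputs in its memory. -/
noncomputable def constStrategy (B : Type*) [Fintype B] (x : X) : SeqStrategy X B where
  dim := memDim (Fintype.card B)
  init := (1 : Matrix (Fin 1) (Fin 1) ℂ) ⊗ₖ Matrix.single x x (1 : ℂ)
  init_isDensity := isDensity_one_fin.kronecker (isDensity_single x)
  step k := appendSingle (finProdFinEquiv.symm.trans
    (Equiv.prodCongr (Equiv.refl (Fin (memDim (Fintype.card B) k)))
      (Fintype.equivFin B).symm)) x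
  step_isChannel _ := isChannel_appendSingle _ x

theorem sldFisher_constStrategy_output
    (hω : ∀ x, IsDiffStateFamily Θ (fun t => ω t x)) (hu : UniqueDiffWithinAt ℝ Θ θ)
    (hθ : θ ∈ Θ) (x : X) (k : ℕ) :
    sldFisher Θ (fun t => (constStrategy B x).output (cqChannel (ω t)) k) θ
      = ((k + 1 : ℕ) : ℝ≥0∞) * sldFisher Θ (fun t => ω t x) θ := by
  induction k with
  | zero =>
    refine (sldFisher_ampl_cqChannel_single hω hu hθ x).trans ?_
    simp
  | succ k ih =>
    have hk := (constStrategy B x).isDiffStateFamily_output hω k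
    let e : Fin (memDim (Fintype.card B) (k + 1)) ≃ Fin (memDim (Fintype.card B) k) × B :=
      finProdFinEquiv.symm.trans (Equiv.prodCongr (Equiv.refl _) (Fintype.equivFin B).symm)
    -- The whole previous output becomes memory and a fresh copy of `ωˣ` is appended, so additivity
    -- applies.
    have hout : (fun t => (constStrategy B x).output (cqChannel (ω t)) (k + 1)) = fun t =>
        ((constStrategy B x).output (cqChannel (ω t)) k).submatrix e e ⊗ₖ ω t x := by
      ext1 t
      exact ampl_cqChannel_kronecker_single (ω t) _ x
    rw [hout]
    refine ((hk.submatrix e).sldFisher_kronecker (hω x) hu hθ).trans ?_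
    refine (congrArg (· + _) ((hk.sldFisher_submatrix e hu hθ).trans ih)).trans ?_
    push_cast
    ring

theorem iSup_sldFisher_output [Nonempty X] (hω : ∀ x, IsDiffStateFamily Θ (fun t => ω t x))
    (hu : UniqueDiffWithinAt ℝ Θ θ) (hθ : θ ∈ Θ) (k : ℕ) :
    (⨆ S : SeqStrategy X B, sldFisher Θ (fun t => S.output (cqChannel (ω t)) k) θ)
      = ((k + 1 : ℕ) : ℝ≥0∞) * ⨆ x, sldFisher Θ (fun t => ω t x) θ := by
  refine le_antisymm (iSup_le fun S => S.sldFisher_output_le hω hu hθ k) ?_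
  obtain ⟨x, hx⟩ := exists_eq_ciSup_of_finite (f := fun x => sldFisher Θ (fun t => ω t x) θ)
  refine le_iSup_of_le (constStrategy B x) ?_
  rw [sldFisher_constStrategy_output hω hu hθ, ← hx]

end Sequential

end CQ

namespace CQ

open MeasureTheory Filter Topology

/-! ### The quantum Cramér–Rao bound. -/

section CramerRao

variable {n : Type*} [Fintype n]

theorem IsBornLaw.isFiniteMeasure {Λ : VectorMeasure ℝ (Matrix n n ℂ)} {ρ : Matrix n n ℂ}
    {P : Measure ℝ} (hP : IsBornLaw Λ ρ P) : IsFiniteMeasure P :=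
  ⟨by rw [hP _ MeasurableSet.univ]; exact ENNReal.ofReal_lt_top⟩

variable [DecidableEq n]

theorem re_trace_mul_nonneg {ρ M : Matrix n n ℂ} (hρ : ρ.PosSemidef) (hM : M.PosSemidef) :
    0 ≤ (ρ * M).trace.re := by
  rw [← cfc_sqrt_mul_self hM]
  exact re_trace_mul_sq_nonneg hρ (isHermitian_cfc M _)

/-- The observable `∫ f dΛ` of a simple function `f` of the outcome of a measurement `Λ`. -/
noncomputable def povmObs (Λ : VectorMeasure ℝ (Matrix n n ℂ)) (f : SimpleFunc ℝ ℝ) :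
    Matrix n n ℂ :=
  ∑ a ∈ f.range, (a : ℂ) • Λ (f ⁻¹' {a})

variable {Λ : VectorMeasure ℝ (Matrix n n ℂ)} {ρ : Matrix n n ℂ} {P : Measure ℝ}

theorem IsPOVM.sum_fibers (hΛ : IsPOVM Λ) (f : SimpleFunc ℝ ℝ) :
    ∑ a ∈ f.range, Λ (f ⁻¹' {a}) = 1 := by
  rw [← VectorMeasure.of_biUnion_finset, ← hΛ.2]
  · congr 1
    ext y
    simp
  · exact fun a _ b _ hab => Disjoint.preimage f (Set.disjoint_singleton.2 hab)
  · exact fun a _ => f.measurableSet_fiber a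

theorem IsPOVM.isHermitian_povmObs (hΛ : IsPOVM Λ) (f : SimpleFunc ℝ ℝ) :
    (povmObs Λ f).IsHermitian := by
  rw [IsHermitian, povmObs, conjTranspose_sum]
  refine Finset.sum_congr rfl fun a _ => ?_
  rw [conjTranspose_smul, (hΛ.1 _).isHermitian.eq, Complex.star_def, Complex.conj_ofReal]

theorem IsBornLaw.real_apply (hP : IsBornLaw Λ ρ P) (hΛ : IsPOVM Λ) (hρ : ρ.PosSemidef)
    {s : Set ℝ} (hs : MeasurableSet s) : P.real s = (ρ * Λ s).trace.re := by
  rw [Measure.real, hP s hs, Matrix.trace_mul_comm,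
    ENNReal.toReal_ofReal (re_trace_mul_nonneg hρ (hΛ.1 s))]

theorem IsBornLaw.integral_simpleFunc (hP : IsBornLaw Λ ρ P) (hΛ : IsPOVM Λ)
    (hρ : ρ.PosSemidef) (f : SimpleFunc ℝ ℝ) :
    ∫ y, f y ∂P = (ρ * povmObs Λ f).trace.re := by
  have := hP.isFiniteMeasure
  rw [f.integral_eq_sum (SimpleFunc.integrable_of_isFiniteMeasure f), povmObs, Matrix.mul_sum,
    Matrix.trace_sum, Complex.re_sum]
  refine Finset.sum_congr rfl fun a _ => ?_
  rw [Matrix.mul_smul, Matrix.trace_smul, smul_eq_mul, smul_eq_mul, Complex.re_ofReal_mul,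
    hP.real_apply hΛ hρ (f.measurableSet_fiber a), mul_comm]

theorem IsBornLaw.integral_simpleFunc_sq (hP : IsBornLaw Λ ρ P) (hΛ : IsPOVM Λ)
    (hρ : ρ.PosSemidef) (f : SimpleFunc ℝ ℝ) :
    ∫ y, (f y) ^ 2 ∂P = ∑ a ∈ f.range, a ^ 2 * (ρ * Λ (f ⁻¹' {a})).trace.re := by
  have := hP.isFiniteMeasure
  have h1 := SimpleFunc.integral_eq_integral (μ := P) (f.map fun x => x ^ 2)
    (SimpleFunc.integrable_of_isFiniteMeasure _)
  rw [SimpleFunc.map_integral _ _ (SimpleFunc.integrable_of_isFiniteMeasure f) (by simp)] at h1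
  simp only [SimpleFunc.map_apply] at h1
  rw [← h1]
  refine Finset.sum_congr rfl fun a _ => ?_
  rw [hP.real_apply hΛ hρ (f.measurableSet_fiber a), smul_eq_mul, mul_comm]

/-- The second moment of `∫ f dΛ` is at most the second moment of `f` under the Born law. -/
theorem IsBornLaw.re_trace_povmObs_sq_le (hP : IsBornLaw Λ ρ P) (hΛ : IsPOVM Λ)
    (hρ : ρ.PosSemidef) (f : SimpleFunc ℝ ℝ) :
    (ρ * (povmObs Λ f * povmObs Λ f)).trace.re ≤ ∫ y, (f y) ^ 2 ∂P := by
  set H := povmObs Λ f with hH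
  have hHH : H.IsHermitian := hΛ.isHermitian_povmObs f
  -- This is the expansion of `(a - H) Λₐ (a - H) ≥ 0`; summing over `a`, with `∑ Λₐ = 1` and `∑ a
  -- Λₐ = H`, leaves `∑ a² Λₐ - H²`.
  have h1 : ∀ a : ℝ, 0 ≤ (ρ * ((a : ℂ) ^ 2 • Λ (f ⁻¹' {a}) - (H * ((a : ℂ) • Λ (f ⁻¹' {a}))
      + ((a : ℂ) • Λ (f ⁻¹' {a})) * H) + H * Λ (f ⁻¹' {a}) * H)).trace.re := by
    intro a
    have hK : ((a : ℂ) • (1 : Matrix n n ℂ) - H)ᴴ = (a : ℂ) • (1 : Matrix n n ℂ) - H := by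
      rw [conjTranspose_sub, hHH.eq, conjTranspose_smul, conjTranspose_one, Complex.star_def,
        Complex.conj_ofReal]
    have h := re_trace_mul_nonneg hρ
      ((hΛ.1 (f ⁻¹' {a})).conjTranspose_mul_mul_same ((a : ℂ) • (1 : Matrix n n ℂ) - H))
    rw [hK] at h
    refine h.trans_eq ?_
    congr 4
    simp only [Matrix.sub_mul, Matrix.mul_sub, Matrix.smul_mul, Matrix.mul_smul, Matrix.one_mul,
      Matrix.mul_one, pow_two, smul_sub, mul_smul]
    abel
  have h2 := Finset.sum_nonneg fun a (_ : a ∈ f.range) => h1 a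
  rw [← Complex.re_sum, ← Matrix.trace_sum, ← Matrix.mul_sum, Finset.sum_add_distrib,
    Finset.sum_sub_distrib, Finset.sum_add_distrib, ← Matrix.mul_sum, ← Matrix.sum_mul,
    ← Matrix.sum_mul, ← Matrix.mul_sum, hΛ.sum_fibers, Matrix.mul_one, ← povmObs, ← hH] at h2
  have h3 : (ρ * ∑ a ∈ f.range, (a : ℂ) ^ 2 • Λ (f ⁻¹' {a})).trace.re
      = ∫ y, (f y) ^ 2 ∂P := by
    rw [hP.integral_simpleFunc_sq hΛ hρ, Matrix.mul_sum, Matrix.trace_sum, Complex.re_sum]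
    refine Finset.sum_congr rfl fun a _ => ?_
    rw [Matrix.mul_smul, Matrix.trace_smul, smul_eq_mul, ← Complex.ofReal_pow,
      Complex.re_ofReal_mul]
  simp only [Matrix.mul_add, Matrix.mul_sub, Matrix.trace_add, Matrix.trace_sub, Complex.add_re,
    Complex.sub_re, h3] at h2
  linarith

/-- The functionals `M ↦ Re Tr[M Hₙ]` converge on the derivative of a family if they converge on
its members. -/
theorem tendsto_re_trace_matDeriv {Θ : Set ℝ} {θ : ℝ} (hθ : θ ∈ Θ) (hacc : AccPt θ (𝓟 Θ))
    {ρ : ℝ → Matrix n n ℂ} {D : Matrix n n ℂ} (hD : HasMatDeriv Θ ρ D θ)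
    (H : ℕ → Matrix n n ℂ)
    (hH : ∀ t ∈ Θ, Tendsto (fun N => (ρ t * H N).trace.re) atTop (𝓝 (t - θ))) :
    Tendsto (fun N => (D * H N).trace.re) atTop (𝓝 1) := by
  -- The pairs (matrix, limit of the functionals on it) form a subspace of a finite-dimensional
  -- space, which is closed. It contains the difference quotients, hence their limit `(D, 1)`; no
  -- interchange of limits is needed.
  let W : Submodule ℝ (Matrix n n ℂ × ℝ) :=
    { carrier := {p | Tendsto (fun N => (p.1 * H N).trace.re) atTop (𝓝 p.2)}
      zero_mem' := by simp
      add_mem' := fun {p q} hp hq => by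
        simpa [Matrix.add_mul, Matrix.trace_add] using Tendsto.add hp hq
      smul_mem' := fun c p hp => by
        simpa [Matrix.smul_mul, Matrix.trace_smul] using Tendsto.const_mul c hp }
  have hW : IsClosed (W : Set (Matrix n n ℂ × ℝ)) := W.closed_of_finiteDimensional
  have : (𝓝[Θ \ {θ}] θ).NeBot := accPt_principal_iff_nhdsWithin.1 hacc
  have hlim : Tendsto (fun t => ((t - θ)⁻¹ • (ρ t - ρ θ), (t - θ)⁻¹ • (t - θ)))
      (𝓝[Θ \ {θ}] θ) (𝓝 (D, (1 : ℝ))) := by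
    refine Tendsto.prodMk_nhds ?_ ?_
    · refine tendsto_pi_nhds.2 fun i => tendsto_pi_nhds.2 fun j => ?_
      exact hasDerivWithinAt_iff_tendsto_slope.1 (hD i j)
    · refine tendsto_const_nhds.congr' ?_
      filter_upwards [self_mem_nhdsWithin] with t ht
      have : t - θ ≠ 0 := sub_ne_zero.2 ht.2
      simp [this]
  have hmem : (D, (1 : ℝ)) ∈ (W : Set (Matrix n n ℂ × ℝ)) := by
    refine hW.mem_of_tendsto hlim ?_
    filter_upwards [self_mem_nhdsWithin] with t ht
    have h1 : (ρ t, t - θ) ∈ W := hH t ht.1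
    have h2 : (ρ θ, θ - θ) ∈ W := hH θ hθ
    simpa using W.smul_mem (t - θ)⁻¹ (W.sub_mem h1 h2)
  exact hmem

/-- The quantum Cramér–Rao bound for unbiased real-valued measurements. -/
theorem inv_sldFisher_le_lintegral_sq {Θ : Set ℝ} {θ : ℝ} (hθ : θ ∈ Θ) (hacc : AccPt θ (𝓟 Θ))
    {ρ : ℝ → Matrix n n ℂ} (hρ : IsDiffStateFamily Θ ρ) (hΛ : IsPOVM Λ) {P : ℝ → Measure ℝ}
    (hP : ∀ t ∈ Θ, IsBornLaw Λ (ρ t) (P t))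
    (hint : ∀ t ∈ Θ, Integrable (fun y : ℝ => y) (P t) ∧ ∫ y, y ∂(P t) = t) :
    (sldFisher Θ ρ θ)⁻¹ ≤ ∫⁻ y, ENNReal.ofReal ((y - θ) ^ 2) ∂(P θ) := by
  have hu : UniqueDiffWithinAt ℝ Θ θ := uniqueDiffWithinAt_iff_accPt.2 hacc
  by_cases hI : sldFisher Θ ρ θ = ⊤
  · simp [hI]
  by_cases hV : ∫⁻ y, ENNReal.ofReal ((y - θ) ^ 2) ∂(P θ) = ⊤
  · simp [hV]
  set D := matDeriv Θ ρ θ with hDdef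
  have hc : ∀ H : Matrix n n ℂ, H.IsHermitian →
      sldObj (ρ θ) D H ≤ (sldFisher Θ ρ θ).toReal :=
    (sldInfo_le_ofReal_iff (hρ.1 θ hθ).1 (hρ.isHermitian_matDeriv hu hθ)
      ENNReal.toReal_nonneg).1 (ENNReal.ofReal_toReal hI).ge
  have hfin : ∀ t ∈ Θ, IsFiniteMeasure (P t) := fun t ht => (hP t ht).isFiniteMeasure
  have hmeas : Measurable fun y : ℝ => y - θ := measurable_id.sub_const θ
  -- One approximating sequence serves every `t`: the domination by `2 |y - θ|` uses only a first
  -- moment under `P t`, and a second moment is needed at `θ` alone.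
  let f : ℕ → SimpleFunc ℝ ℝ := SimpleFunc.approxOn (fun y => y - θ) hmeas Set.univ 0 trivial
  have hf : ∀ y, Tendsto (fun N => f N y) atTop (𝓝 (y - θ)) := fun y =>
    SimpleFunc.tendsto_approxOn hmeas (Set.mem_univ 0) (by simp)
  have hfb : ∀ N y, |f N y| ≤ 2 * |y - θ| := fun N y => by
    have := SimpleFunc.norm_approxOn_zero_le hmeas (s := Set.univ) trivial y N
    simp only [Real.norm_eq_abs] at this
    linarith
  have hsq : Integrable (fun y => (y - θ) ^ 2) (P θ) := by
    refine ⟨(hmeas.pow_const 2).aestronglyMeasurable, ?_⟩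
    rw [hasFiniteIntegral_iff_ofReal (Eventually.of_forall fun y => sq_nonneg _)]
    exact lt_top_iff_ne_top.2 hV
  set v := ∫ y, (y - θ) ^ 2 ∂(P θ) with hv
  have hVv : ∫⁻ y, ENNReal.ofReal ((y - θ) ^ 2) ∂(P θ) = ENNReal.ofReal v :=
    (ofReal_integral_eq_lintegral_ofReal hsq (Eventually.of_forall fun y => sq_nonneg _)).symm
  have hlim1 : ∀ t ∈ Θ, Tendsto (fun N => (ρ t * povmObs Λ (f N)).trace.re) atTop
      (𝓝 (t - θ)) := by
    intro t ht
    have := hfin t ht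
    have huniv : (P t).real Set.univ = 1 := by
      rw [(hP t ht).real_apply hΛ (hρ.1 t ht).1 MeasurableSet.univ, hΛ.2, Matrix.mul_one,
        (hρ.1 t ht).2, Complex.one_re]
    have hi : Integrable (fun y => y - θ) (P t) := (hint t ht).1.sub (integrable_const θ)
    have hval : ∫ y, (y - θ) ∂(P t) = t - θ := by
      rw [integral_sub (hint t ht).1 (integrable_const θ), (hint t ht).2, integral_const, huniv,
        one_smul]
    simp only [← (hP t ht).integral_simpleFunc hΛ (hρ.1 t ht).1]
    rw [← hval]
    refine tendsto_integral_of_dominated_convergence (fun y => 2 * |y - θ|)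
      (fun N => (f N).measurable.aestronglyMeasurable) (hi.abs.const_mul 2)
      (fun N => Eventually.of_forall fun y => hfb N y) (Eventually.of_forall hf)
  have hlim2 : Tendsto (fun N => ∫ y, (f N y) ^ 2 ∂(P θ)) atTop (𝓝 v) := by
    refine tendsto_integral_of_dominated_convergence (fun y => 4 * (y - θ) ^ 2)
      (fun N => ((f N).measurable.pow_const 2).aestronglyMeasurable) (hsq.const_mul 4)
      (fun N => Eventually.of_forall fun y => ?_) (Eventually.of_forall fun y => (hf y).pow 2)
    rw [Real.norm_eq_abs, abs_of_nonneg (sq_nonneg _), ← sq_abs (f N y), ← sq_abs (y - θ)]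
    nlinarith [hfb N y, abs_nonneg (f N y), abs_nonneg (y - θ)]
  have hlim3 := tendsto_re_trace_matDeriv hθ hacc (hρ.hasMatDeriv hθ) (fun N => povmObs Λ (f N))
    hlim1
  -- The limit of the variational bound for `s` times the approximating observables. The optimal
  -- choice is `s = v⁻¹`; for `v = 0` the left side would be unbounded in `s`.
  have key : ∀ s : ℝ, 2 * (s * 1) - s ^ 2 * v ≤ (sldFisher Θ ρ θ).toReal := by
    intro s
    refine le_of_tendsto (((hlim3.const_mul s).const_mul 2).sub (hlim2.const_mul (s ^ 2)))
      (Eventually.of_forall fun N => ?_)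
    have hHH := hΛ.isHermitian_povmObs (f N)
    have h := hc ((s : ℂ) • povmObs Λ (f N)) (by
      rw [IsHermitian, conjTranspose_smul, hHH.eq, Complex.star_def, Complex.conj_ofReal])
    have h2 := mul_le_mul_of_nonneg_left
      ((hP θ hθ).re_trace_povmObs_sq_le hΛ (hρ.1 θ hθ).1 (f N)) (sq_nonneg s)
    simp only [sldObj, Matrix.mul_smul, Matrix.smul_mul, Matrix.trace_smul, smul_eq_mul,
      Complex.re_ofReal_mul] at h
    linarith
  have hv0 : 0 ≤ v := integral_nonneg fun y => sq_nonneg _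
  rcases hv0.eq_or_lt with h0 | hpos
  · have := key ((sldFisher Θ ρ θ).toReal + 1)
    rw [← h0] at this
    have := ENNReal.toReal_nonneg (a := sldFisher Θ ρ θ)
    linarith
  · have h := key v⁻¹
    have h1 : v⁻¹ ≤ (sldFisher Θ ρ θ).toReal := by
      have : 2 * (v⁻¹ * 1) - v⁻¹ ^ 2 * v = v⁻¹ := by field_simp; norm_num
      linarith
    rw [hVv, ENNReal.inv_le_iff_inv_le, ← ENNReal.ofReal_inv_of_pos hpos,
      ← ENNReal.ofReal_toReal hI]
    exact ENNReal.ofReal_le_ofReal h1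

end CramerRao

end CQ
theorem mainTheorem5 {X B : Type*} [Fintype X] [DecidableEq X] [Nonempty X]
    [Fintype B] [DecidableEq B]
    -- the parameter set, and a parameter value at which derivatives make sense
    (Θ : Set ℝ) (θ : ℝ) (hθ : θ ∈ Θ) (hacc : AccPt θ (Filter.principal Θ))
    -- the output states `ω^{x,t}`, each of them differentiable in the parameter `t`
    (ω : ℝ → X → Matrix B B ℂ)
    (hω : ∀ x, CQ.IsDiffStateFamily Θ (fun t => ω t x)) :
    -- the amortization collapse
    (CQ.channelFisher Θ (fun t => CQ.cqChannel (ω t)) θ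
        = ⨆ x, CQ.sldFisher Θ (fun t => ω t x) θ) ∧
    (CQ.amortizedFisher Θ (fun t => CQ.cqChannel (ω t)) θ
        = ((⨆ x, CQ.sldFisher Θ (fun t => ω t x) θ : ENNReal) : EReal)) ∧
    -- optimal parallel and optimal sequential strategies agree, and scale linearly
    (∀ k : ℕ,
      (CQ.channelFisher Θ (fun t => CQ.tensorPow (k + 1) (CQ.cqChannel (ω t))) θ
        = ((k + 1 : ℕ) : ENNReal) * ⨆ x, CQ.sldFisher Θ (fun t => ω t x) θ) ∧
      (⨆ S : CQ.SeqStrategy X B,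
          CQ.sldFisher Θ (fun t => S.output (CQ.cqChannel (ω t)) k) θ)
        = ((k + 1 : ℕ) : ENNReal) * ⨆ x, CQ.sldFisher Θ (fun t => ω t x) θ) ∧
    -- mean squared error of an unbiased estimator at the end of a sequential strategy
    (∀ (k : ℕ) (S : CQ.SeqStrategy X B)
      (Λ : MeasureTheory.VectorMeasure ℝ
        (Matrix (Fin (S.dim k) × B) (Fin (S.dim k) × B) ℂ))
      (P : ℝ → MeasureTheory.Measure ℝ),
      CQ.IsPOVM Λ →
      (∀ t ∈ Θ, CQ.IsBornLaw Λ (S.output (CQ.cqChannel (ω t)) k) (P t)) →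
      (∀ t ∈ Θ, MeasureTheory.Integrable (fun y : ℝ => y) (P t) ∧ ∫ y, y ∂(P t) = t) →
      (((k + 1 : ℕ) : ENNReal) * ⨆ x, CQ.sldFisher Θ (fun t => ω t x) θ)⁻¹
        ≤ ∫⁻ y, ENNReal.ofReal ((y - θ) ^ 2) ∂(P θ)) := by
  -- On the real line, being an accumulation point is the same as uniqueness of derivatives within
  -- `Θ`, which lets `matDeriv` obey the sum and product rules.
  have hu : UniqueDiffWithinAt ℝ Θ θ := uniqueDiffWithinAt_iff_accPt.2 hacc
  refine ⟨CQ.channelFisher_cqChannel hω hu hθ, CQ.amortizedFisher_cqChannel hω hu hθ,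
    fun k => ⟨CQ.channelFisher_tensorPow_cqChannel hω hu hθ (k + 1),
      CQ.iSup_sldFisher_output hω hu hθ k⟩, fun k S Λ P hΛ hP hint => ?_⟩
  exact (ENNReal.inv_le_inv.2 (S.sldFisher_output_le hω hu hθ k)).trans
    (CQ.inv_sldFisher_le_lintegral_sq hθ hacc (S.isDiffStateFamily_output hω k) hΛ hP hint)
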